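/- Let $\Omega=[a,b]$, $a<b$, with periodic boundary conditions, let $k\ge 0$ and $q\ge 1$ be integers, $\gamma=\lfloor q/2\rfloor$, and let $\theta_1,\dots,\theta_\gamma\in\mathbb R\setminus\{\tfrac12\}$, and $\theta_0\in\mathbb R\setminus\{\tfrac12\}$ if $q$ is odd. For a mesh $a=x_{1/2}<x_{3/2}<\dots<x_{N+1/2}=b$, $N\ge 1$, with cells $I_j=[x_{j-1/2},x_{j+1/2}]$ and mesh size $h=\max_j|I_j|$, which is quasi-uniform, i.e. $h\le\sigma|I_j|$ for all $j$, let $V_h=\{v\in L^2(\Omega): v|_{I_j}\in P^k(I_j)\ \forall j\}$ and $Z_h=\{v\in V_h:\langle v,1\rangle=0\}$, where $\langle\cdot,\cdot\rangle$ and $\|\cdot\|$ are the inner product and the norm of $L^2(\Omega)$, and let $\Pi_0$ be the $L^2$ projection onto $V_h$. For $\theta\in\mathbb R$ define $D_{h,\theta}:V_h\to V_h$ by $$\langle D_{h,\theta}w_h,v_h\rangle=-\sum_j\int_{I_j} w_h\,\partial_xv_h\,dx-\sum_{j=1}^N\bigl(\theta w_h^-+(1-\theta)w_h^+\bigr)_{j+\frac12}\,(v_h^+-v_h^-)_{j+\frac12}\qquad\forall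 v_h\in V_h,$$ where $v^\mp$ are the left and right limits, extended periodically at $x_{N+1/2}\sim x_{1/2}$. For constant $\beta\in\mathbb R$ let $L=\beta\partial_x^q$, $K_h=D_{h,\theta_1}\cdots D_{h,\theta_\gamma}$, let $K_h^\top$ be the transpose of $K_h$ with respect to $\langle\cdot,\cdot\rangle$, and let $$L_h=\begin{cases}(-1)^\gamma\beta K_h^\top K_h,& q=2\gamma,\\ (-1)^\gamma\beta K_h^\top D_{h,\theta_0}K_h,& q=2\gamma+1.\end{cases}$$ Then $D_{h,\theta}:Z_h\to Z_h$ is a bijection for every $\theta\ne\frac12$; denote its inverse by $D_{h,\theta}^{-1}$. For every $w$ in the periodic Sobolev space $H^{k+1+q}(\Omega)$, $\Pi_0\partial_x^qw\in Z_h$, so that $$\Pi w=\begin{cases}(D_{h,\theta_\gamma}^{-1}\cdots D_{h,\theta_1}^{-1})(D_{h,1-\theta_1}^{-1}\cdots D_{h,1-\theta_\gamma}^{-1})\Pi_0\partial_x^qw+\frac{\langle w,1\rangle}{\langle 1,1\rangle},&q=2\gamma,\\[2pt](D_{h,\theta_\gamma}^{-1}\cdots D_{h,\theta_1}^{-1})D_{h,\theta_0}^{-1}(D_{h,1-\theta_1}^{-1}\cdots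 D_{h,1-\theta_\gamma}^{-1})\Pi_0\partial_x^qw+\frac{\langle w,1\rangle}{\langle 1,1\rangle},&q=2\gamma+1\end{cases}$$ is well defined, and $$\|w-\Pi w\|\le C\,\|w\|_{k+1+q}\,h^{k+1},$$ where $\|\cdot\|_{m}$ is the $H^m(\Omega)$ norm and $C>0$ depends only on $\Omega$, $k$, $q$, the $\theta_i$ and $\sigma$, not on the mesh or $w$. Moreover $L_h\Pi w=\Pi_0Lw$ for every $\beta$; hence $\langle (L-L_h\Pi)w,v_h\rangle=0$ for all $v_h\in V_h$. -/

import Mathlib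

open MeasureTheory Polynomial

noncomputable section

namespace LDG

/-- A partition `a = x_{1/2} < x_{3/2} < ... < x_{N+1/2} = b` of `Ω = [a, b]` into `N` cells;
`node j` is `x_{j+1/2}`, `j = 0, ..., N`. -/
structure Mesh (a b : ℝ) (N : ℕ) where
  node : Fin (N + 1) → ℝ
  strictMono_node : StrictMono node
  node_zero : node 0 = a
  node_last : node (Fin.last N) = b

/-- The discontinuous finite element space `V_h`: a polynomial of degree at most `k` on each of
the `N` cells. The associated function on `Ω` is `Mesh.toFun` below. -/
abbrev DGSpace (N k : ℕ) : Type := Fin N → degreeLT ℝ (k + 1)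

namespace Mesh

variable {a b : ℝ} {N : ℕ} (M : Mesh a b N)

/-- Left end point of the cell `I_j`. -/
def left (j : Fin N) : ℝ := M.node j.castSucc

/-- Right end point of the cell `I_j`. -/
def right (j : Fin N) : ℝ := M.node j.succ

/-- The length of the cell `I_j`. -/
def width (j : Fin N) : ℝ := M.right j - M.left j

/-- The mesh size `h = max_j |I_j|`. -/
def size [NeZero N] : ℝ := Finset.univ.sup' Finset.univ_nonempty M.width

/-- Quasi-uniformity with constant `σ`: `h ≤ σ |I_j|` for all `j`. -/
def QuasiUniform [NeZero N] (σ : ℝ) : Prop := ∀ j, M.size ≤ σ * M.width j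

theorem left_lt_right (j : Fin N) : M.left j < M.right j :=
  M.strictMono_node Fin.castSucc_lt_succ

variable {k : ℕ}

/-- The piecewise polynomial function on `Ω` given by an element of `V_h` (the value at an
interior node, which is irrelevant in `L²`, is taken from the right). -/
def toFun (v : DGSpace N k) (x : ℝ) : ℝ :=
  ∑ j, (Set.Ico (M.left j) (M.right j)).indicator (fun y => (v j : ℝ[X]).eval y) x

/-- The `L²(Ω)` inner product on `V_h`, `⟨v, w⟩ = ∑_j ∫_{I_j} v w`. -/
def inner : LinearMap.BilinForm ℝ (DGSpace N k) :=
  LinearMap.mk₂ ℝ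
    (fun v w => ∑ j, ∫ x in M.left j..M.right j, (v j : ℝ[X]).eval x * (w j : ℝ[X]).eval x)
    (fun v v' w => by
      rw [← Finset.sum_add_distrib]
      refine Finset.sum_congr rfl fun j _ => ?_
      rw [← intervalIntegral.integral_add (Continuous.intervalIntegrable (by fun_prop) _ _)
        (Continuous.intervalIntegrable (by fun_prop) _ _)]
      simp [add_mul])
    (fun c v w => by
      rw [smul_eq_mul, Finset.mul_sum]
      refine Finset.sum_congr rfl fun j _ => ?_
      rw [← intervalIntegral.integral_const_mul]
      simp [mul_assoc])
    (fun v w w' => by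
      rw [← Finset.sum_add_distrib]
      refine Finset.sum_congr rfl fun j _ => ?_
      rw [← intervalIntegral.integral_add (Continuous.intervalIntegrable (by fun_prop) _ _)
        (Continuous.intervalIntegrable (by fun_prop) _ _)]
      simp [mul_add])
    (fun c v w => by
      rw [smul_eq_mul, Finset.mul_sum]
      refine Finset.sum_congr rfl fun j _ => ?_
      rw [← intervalIntegral.integral_const_mul]
      simp [mul_left_comm])

theorem inner_apply (v w : DGSpace N k) :
    M.inner v w =
      ∑ j, ∫ x in M.left j..M.right j, (v j : ℝ[X]).eval x * (w j : ℝ[X]).eval x := rfl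

theorem inner_self_eq_zero {v : DGSpace N k} (h : M.inner v v = 0) : v = 0 := by
  rw [inner_apply, Finset.sum_eq_zero_iff_of_nonneg] at h
  · funext j
    have hj := h j (Finset.mem_univ j)
    have hlt := M.left_lt_right j
    by_contra hne
    have hp : (v j : ℝ[X]) ≠ 0 := fun h0 => hne (Subtype.ext h0)
    have hinf : (Set.Ioo (M.left j) (M.right j)).Infinite := Set.Ioo_infinite hlt
    obtain ⟨c, hc, hc0⟩ : ∃ c ∈ Set.Ioo (M.left j) (M.right j), (v j : ℝ[X]).eval c ≠ 0 := by
      by_contra! hall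
      exact hp (Polynomial.eq_zero_of_infinite_isRoot _ (hinf.mono fun c hc => hall c hc))
    have hpos : 0 < ∫ x in M.left j..M.right j, (v j : ℝ[X]).eval x * (v j : ℝ[X]).eval x :=
      intervalIntegral.integral_pos hlt (Continuous.continuousOn (by fun_prop))
        (fun x _ => mul_self_nonneg _) ⟨c, Set.Ioo_subset_Icc_self hc, mul_self_pos.2 hc0⟩
    exact hpos.ne' hj
  · intro j _
    exact intervalIntegral.integral_nonneg (M.left_lt_right j).le fun x _ => mul_self_nonneg _

theorem inner_nondegenerate : (M.inner (k := k)).Nondegenerate :=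
  ⟨fun _ hv => M.inner_self_eq_zero (hv _), fun _ hv => M.inner_self_eq_zero (hv _)⟩

/-- `Z_h`, the elements of `V_h` of mean zero. -/
def zeroMean : Set (DGSpace N k) :=
  {v | ∑ j, ∫ x in M.left j..M.right j, (v j : ℝ[X]).eval x = 0}

theorem intervalIntegrable_cell {f : ℝ → ℝ} (hf : IntervalIntegrable f volume a b) (j : Fin N) :
    IntervalIntegrable f volume (M.left j) (M.right j) := by
  have h0 : a ≤ M.left j :=
    M.node_zero.symm.le.trans (M.strictMono_node.monotone (Fin.zero_le _))
  have h1 : M.right j ≤ b :=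
    (M.strictMono_node.monotone (Fin.le_last _)).trans M.node_last.le
  have h2 := (M.left_lt_right j).le
  refine hf.mono_set ?_
  rw [Set.uIcc_of_le h2, Set.uIcc_of_le (h0.trans (h2.trans h1))]
  exact Set.Icc_subset_Icc h0 h1

/-- The functional `v ↦ ⟨f, v⟩ = ∑_j ∫_{I_j} f v` on `V_h`, for `f` integrable on `Ω`. -/
def moment (f : ℝ → ℝ) (hf : IntervalIntegrable f volume a b) :
    Module.Dual ℝ (DGSpace N k) where
  toFun v := ∑ j, ∫ x in M.left j..M.right j, f x * (v j : ℝ[X]).eval x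
  map_add' v w := by
    rw [← Finset.sum_add_distrib]
    refine Finset.sum_congr rfl fun j _ => ?_
    have hj := M.intervalIntegrable_cell hf j
    rw [← intervalIntegral.integral_add
      (hj.mul_continuousOn (Continuous.continuousOn (by fun_prop)))
      (hj.mul_continuousOn (Continuous.continuousOn (by fun_prop)))]
    simp [mul_add]
  map_smul' c v := by
    rw [RingHom.id_apply, smul_eq_mul, Finset.mul_sum]
    refine Finset.sum_congr rfl fun j _ => ?_
    rw [← intervalIntegral.integral_const_mul]
    simp [mul_left_comm]

open Classical in
/-- The `L²` projection `Π₀` onto `V_h`: `⟨Π₀ f, v⟩ = ⟨f, v⟩` for all `v ∈ V_h`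
(with value `0` for `f` not integrable on `Ω`). -/
def proj₀ (k : ℕ) (f : ℝ → ℝ) : DGSpace N k :=
  if hf : IntervalIntegrable f volume a b then
    (M.inner.toDual M.inner_nondegenerate).symm (M.moment f hf)
  else 0

/-- The constant function `c` as an element of `V_h`. -/
def const (N k : ℕ) (c : ℝ) : DGSpace N k := fun _ =>
  ⟨C c, mem_degreeLT.2 (degree_C_le.trans_lt (by exact_mod_cast Nat.succ_pos k))⟩

section Periodic

variable [NeZero N]

/-- The left limit `v⁻` at the right end point `x_{j+1/2}` of the cell `I_j`. -/
def traceMinus (j : Fin N) (v : DGSpace N k) : ℝ := (v j : ℝ[X]).eval (M.right j)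

/-- The right limit `v⁺` at the right end point `x_{j+1/2}` of the cell `I_j`. By periodicity the
cell to the right of the last one is the first one: the sum `j + 1` in `Fin N` is cyclic. -/
def tracePlus (j : Fin N) (v : DGSpace N k) : ℝ := (v (j + 1) : ℝ[X]).eval (M.left (j + 1))

/-- The jump `[v] = v⁺ - v⁻` at `x_{j+1/2}`. -/
def jump (j : Fin N) (v : DGSpace N k) : ℝ := M.tracePlus j v - M.traceMinus j v

/-- The numerical flux `θ w⁻ + (1 - θ) w⁺` at `x_{j+1/2}`. -/
def flux (θ : ℝ) (j : Fin N) (w : DGSpace N k) : ℝ :=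
  θ * M.traceMinus j w + (1 - θ) * M.tracePlus j w

/-- The DG bilinear form `(w, v) ↦ -⟨w, ∂ₓ v⟩ - ∑_j ŵ_{j+1/2} [v]_{j+1/2}`. -/
def dgForm (θ : ℝ) : LinearMap.BilinForm ℝ (DGSpace N k) :=
  LinearMap.mk₂ ℝ
    (fun w v =>
      -(∑ j, ∫ x in M.left j..M.right j, (w j : ℝ[X]).eval x * (derivative (v j : ℝ[X])).eval x)
        - ∑ j, M.flux θ j w * M.jump j v)
    (fun w w' v => by
      have h : ∀ j, (∫ x in M.left j..M.right j,
          ((w + w') j : ℝ[X]).eval x * (derivative (v j : ℝ[X])).eval x) =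
          (∫ x in M.left j..M.right j, (w j : ℝ[X]).eval x * (derivative (v j : ℝ[X])).eval x) +
          ∫ x in M.left j..M.right j,
            (w' j : ℝ[X]).eval x * (derivative (v j : ℝ[X])).eval x := fun j => by
        rw [← intervalIntegral.integral_add (Continuous.intervalIntegrable (by fun_prop) _ _)
          (Continuous.intervalIntegrable (by fun_prop) _ _)]
        simp [add_mul]
      have h' : ∀ j, M.flux θ j (w + w') * M.jump j v =
          M.flux θ j w * M.jump j v + M.flux θ j w' * M.jump j v := fun j => by
        simp [flux, traceMinus, tracePlus]; ring
      simp only [h, h', Finset.sum_add_distrib]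
      ring)
    (fun c w v => by
      have h : ∀ j, (∫ x in M.left j..M.right j,
          ((c • w) j : ℝ[X]).eval x * (derivative (v j : ℝ[X])).eval x) =
          c * ∫ x in M.left j..M.right j,
            (w j : ℝ[X]).eval x * (derivative (v j : ℝ[X])).eval x := fun j => by
        rw [← intervalIntegral.integral_const_mul]
        simp [mul_assoc]
      have h' : ∀ j, M.flux θ j (c • w) * M.jump j v =
          c * (M.flux θ j w * M.jump j v) := fun j => by
        simp [flux, traceMinus, tracePlus]; ring
      simp only [h, h', ← Finset.mul_sum, smul_eq_mul]
      ring)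
    (fun w v v' => by
      have h : ∀ j, (∫ x in M.left j..M.right j,
          (w j : ℝ[X]).eval x * (derivative ((v + v') j : ℝ[X])).eval x) =
          (∫ x in M.left j..M.right j, (w j : ℝ[X]).eval x * (derivative (v j : ℝ[X])).eval x) +
          ∫ x in M.left j..M.right j,
            (w j : ℝ[X]).eval x * (derivative (v' j : ℝ[X])).eval x := fun j => by
        rw [← intervalIntegral.integral_add (Continuous.intervalIntegrable (by fun_prop) _ _)
          (Continuous.intervalIntegrable (by fun_prop) _ _)]
        simp [mul_add]
      have h' : ∀ j, M.flux θ j w * M.jump j (v + v') =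
          M.flux θ j w * M.jump j v + M.flux θ j w * M.jump j v' := fun j => by
        simp [jump, traceMinus, tracePlus]; ring
      simp only [h, h', Finset.sum_add_distrib]
      ring)
    (fun c w v => by
      have h : ∀ j, (∫ x in M.left j..M.right j,
          (w j : ℝ[X]).eval x * (derivative ((c • v) j : ℝ[X])).eval x) =
          c * ∫ x in M.left j..M.right j,
            (w j : ℝ[X]).eval x * (derivative (v j : ℝ[X])).eval x := fun j => by
        rw [← intervalIntegral.integral_const_mul]
        simp [mul_left_comm]
      have h' : ∀ j, M.flux θ j w * M.jump j (c • v) =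
          c * (M.flux θ j w * M.jump j v) := fun j => by
        simp [jump, traceMinus, tracePlus]; ring
      simp only [h, h', ← Finset.mul_sum, smul_eq_mul]
      ring)

/-- The DG operator `D_{h,θ} : V_h → V_h`, `⟨D_{h,θ} w, v⟩ = dgForm θ w v` for all `v ∈ V_h`. -/
def D (k : ℕ) (θ : ℝ) : DGSpace N k →ₗ[ℝ] DGSpace N k :=
  (M.inner.toDual M.inner_nondegenerate).symm.toLinearMap ∘ₗ M.dgForm θ

theorem inner_D (θ : ℝ) (w v : DGSpace N k) : M.inner (M.D k θ w) v = M.dgForm θ w v :=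
  LinearMap.BilinForm.apply_toDual_symm_apply (hB := M.inner_nondegenerate) _ _

/-- The inverse `D_{h,θ}⁻¹` of `D_{h,θ} : Z_h → Z_h`. -/
def Dinv (k : ℕ) (θ : ℝ) : DGSpace N k → DGSpace N k :=
  Function.invFunOn (M.D k θ) M.zeroMean

/-- The list `[θ₁, ..., θ_γ]`. -/
def thetaList (θ : ℕ → ℝ) (γ : ℕ) : List ℝ := (List.range' 1 γ).map θ

/-- `K_h = D_{h,θ₁} D_{h,θ₂} ⋯ D_{h,θ_γ}`. -/
def K (k γ : ℕ) (θ : ℕ → ℝ) : Module.End ℝ (DGSpace N k) :=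
  ((thetaList θ γ).map (M.D k)).prod

/-- The transpose with respect to the `L²` inner product of `V_h`. -/
def transpose (A : Module.End ℝ (DGSpace N k)) : Module.End ℝ (DGSpace N k) :=
  M.inner.leftAdjointOfNondegenerate M.inner_nondegenerate A

open Classical in
/-- The discrete operator `L_h` of the LDG scheme for `∂_t u = β ∂ₓ^q u`:
`(-1)^γ β K_hᵀ K_h` if `q = 2γ`, and `(-1)^γ β K_hᵀ D_{h,θ₀} K_h` if `q = 2γ + 1`. -/
def Lh (k q : ℕ) (β : ℝ) (θ : ℕ → ℝ) : Module.End ℝ (DGSpace N k) :=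
  ((-1) ^ (q / 2) * β) •
    (if Even q then M.transpose (M.K k (q / 2) θ) * M.K k (q / 2) θ
      else M.transpose (M.K k (q / 2) θ) * M.D k (θ 0) * M.K k (q / 2) θ)

/-- `(D_{h,θ_γ}⁻¹ ⋯ D_{h,θ₁}⁻¹) z`. -/
def outerInv (k γ : ℕ) (θ : ℕ → ℝ) (z : DGSpace N k) : DGSpace N k :=
  (thetaList θ γ).foldl (fun y t => M.Dinv k t y) z

/-- `(D_{h,1-θ₁}⁻¹ ⋯ D_{h,1-θ_γ}⁻¹) z`. -/
def innerInv (k γ : ℕ) (θ : ℕ → ℝ) (z : DGSpace N k) : DGSpace N k :=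
  (thetaList θ γ).foldr (fun t y => M.Dinv k (1 - t) y) z

open Classical in
/-- The operator `Π`. -/
def ldgProj (k q : ℕ) (θ : ℕ → ℝ) (w : ℝ → ℝ) : DGSpace N k :=
  (if Even q then
      M.outerInv k (q / 2) θ (M.innerInv k (q / 2) θ (M.proj₀ k (iteratedDeriv q w)))
    else
      M.outerInv k (q / 2) θ
        (M.Dinv k (θ 0) (M.innerInv k (q / 2) θ (M.proj₀ k (iteratedDeriv q w)))))
  + const N k ((∫ x in a..b, w x) / ∫ _x in a..b, (1 : ℝ))

end Periodic

end Mesh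

/-- The `L²(a, b)` norm. -/
def l2norm (a b : ℝ) (f : ℝ → ℝ) : ℝ := √(∫ x in a..b, f x ^ 2)

/-- Membership in the periodic Sobolev space `H^m` on `[a, b]`, for the continuously
differentiable representative: `w` is `(b - a)`-periodic and `C^{m-1}`, its derivatives of order
less than `m` are absolutely continuous on `[a, b]`, and those of order at most `m` are in
`L²(a, b)`. -/
structure MemPeriodicSobolev (a b : ℝ) (m : ℕ) (w : ℝ → ℝ) : Prop where
  periodic : Function.Periodic w (b - a)
  contDiff : ∀ i : ℕ, i < m → ContDiff ℝ i w
  absCont : ∀ i : ℕ, i < m → AbsolutelyContinuousOnInterval (iteratedDeriv i w) a b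
  memLp : ∀ i : ℕ, i ≤ m → MemLp (iteratedDeriv i w) 2 (volume.restrict (Set.Ioc a b))

/-- The Sobolev norm `‖w‖_m = (∑_{i ≤ m} ‖∂ₓ^i w‖²)^{1/2}`. -/
def sobolevNorm (a b : ℝ) (m : ℕ) (w : ℝ → ℝ) : ℝ :=
  √(∑ i ∈ Finset.range (m + 1), l2norm a b (iteratedDeriv i w) ^ 2)

/-- The differential operator `L w = β ∂ₓ^q w`. -/
def diffOp (β : ℝ) (q : ℕ) (w : ℝ → ℝ) (x : ℝ) : ℝ := β * iteratedDeriv q w x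

end LDG

end

/-! The engine is a commuting relation between `D_{h,θ}` and the generalized Gauss-Radau projection
`p` of a continuous periodic `u`: `p` has the moments of `u` against degree less than `k`, and its
flux at each node is the value of `u`. Integration by parts then gives `D_{h,θ} p = Π₀ u'` exactly
(`D_eq_proj₀`). Such a `p` is the `L²` projection plus a multiple of the Legendre polynomial on each
cell. The multiples solve a cyclic two-term system that is invertible, uniformly in `N`, because
`|θ| ≠ |1 - θ|` (`exists_gaussRadau`).

Applied to the primitive of a mean-zero `z ∈ V_h`, the relation solves `D_{h,θ} y = z` in `Z_h` with
an `L²` bound independent of the mesh (`exists_D_eq`). Bijectivity follows, since the transpose of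
`D_{h,θ}` is `-D_{h,1-θ}` (`inner_D_left`, `bijOn_D`).

For the error, the `q` inverses in `Π` are applied one at a time. After `m` of them the result is
compared with `Π₀ ∂ₓ^(q-m) w`, normalized to mean zero. Each step costs one stability constant and
one Gauss-Radau error of order `h^(k+1)` (`exists_foldl_Dinv_error`). After all `q` steps `Πw` is
within `O(h^(k+1))` of `Π₀ w`, and Pythagoras finishes the estimate.

The identity for `L_h` is algebraic: `K_h` cancels the outer inverses, `K_hᵀ` cancels the inner ones
up to `(-1)^γ`, and constants are annihilated (`Lh_ldgProj`). -/

namespace LDG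

/-! ### Polynomials on one cell: inverse inequality, Legendre polynomials, approximation -/

/-- The mesh of `[0, 1]` with a single cell. -/
noncomputable def unitMesh : Mesh 0 1 1 where
  node := ![0, 1]
  strictMono_node := by
    intro i j h
    fin_cases i <;> fin_cases j <;> simp_all
  node_zero := rfl
  node_last := rfl

theorem Mesh.inner_self_nonneg {a b : ℝ} {N k : ℕ} (M : Mesh a b N) (v : DGSpace N k) :
    0 ≤ M.inner v v := by
  rw [Mesh.inner_apply]
  exact Finset.sum_nonneg fun j _ => intervalIntegral.integral_nonneg (M.left_lt_right j).le
    fun x _ => mul_self_nonneg _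

theorem Mesh.inner_comm {a b : ℝ} {N k : ℕ} (M : Mesh a b N) (v w : DGSpace N k) :
    M.inner v w = M.inner w v := by
  simp only [Mesh.inner_apply, mul_comm]

theorem Mesh.inner_sq_le {a b : ℝ} {N k : ℕ} (M : Mesh a b N) (v w : DGSpace N k) :
    M.inner v w ^ 2 ≤ M.inner v v * M.inner w w :=
  LinearMap.BilinForm.apply_sq_le_of_symm _ M.inner_self_nonneg
    ⟨fun v w => M.inner_comm v w⟩ v w

theorem Mesh.inner_add_self_le {a b : ℝ} {N k : ℕ} (M : Mesh a b N) (v w : DGSpace N k) :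
    M.inner (v + w) (v + w) ≤ 2 * M.inner v v + 2 * M.inner w w := by
  have h := M.inner_self_nonneg (v - w)
  simp only [map_add, map_sub, LinearMap.add_apply, LinearMap.sub_apply] at h ⊢
  linarith

/-- The `i`-th coefficient as a functional on the polynomials of degree at most `k`. -/
noncomputable def coeffDual (k i : ℕ) : Module.Dual ℝ (DGSpace 1 k) where
  toFun v := (v 0 : ℝ[X]).coeff i
  map_add' v w := by simp
  map_smul' c v := by simp

/-- Each coefficient is a linear functional, so it has a Riesz representer in the `L²` inner
product, and Cauchy-Schwarz bounds it by the `L²` norm. On `[0, 1]` the powers of `x` are at most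
`1`, so the `k + 1` coefficients control the value. -/
theorem exists_eval_sq_le_unit (k : ℕ) : ∃ C : ℝ, 0 ≤ C ∧ ∀ p ∈ degreeLT ℝ (k + 1),
    ∀ x ∈ Set.Icc (0 : ℝ) 1, p.eval x ^ 2 ≤ C * ∫ y in (0 : ℝ)..1, p.eval y ^ 2 := by
  let e := unitMesh.inner.toDual (unitMesh.inner_nondegenerate (k := k))
  let r : ℕ → DGSpace 1 k := fun i => e.symm (coeffDual k i)
  have hr0 : ∀ i, 0 ≤ unitMesh.inner (r i) (r i) := fun i => unitMesh.inner_self_nonneg _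
  refine ⟨(k + 1) * ∑ i ∈ Finset.range (k + 1), unitMesh.inner (r i) (r i),
    mul_nonneg (by positivity) (Finset.sum_nonneg fun i _ => hr0 i), fun p hp x hx => ?_⟩
  let v : DGSpace 1 k := fun _ => ⟨p, hp⟩
  have hv : unitMesh.inner v v = ∫ y in (0 : ℝ)..1, p.eval y ^ 2 := by
    rw [Mesh.inner_apply, Fin.sum_univ_one]
    have h1 : unitMesh.left 0 = 0 := rfl
    have h2 : unitMesh.right 0 = 1 := rfl
    simp only [h1, h2, v, sq]
  have hc : ∀ i, p.coeff i ^ 2 ≤ unitMesh.inner (r i) (r i) * unitMesh.inner v v := fun i => by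
    have h : unitMesh.inner (r i) v = p.coeff i :=
      LinearMap.BilinForm.apply_toDual_symm_apply (hB := unitMesh.inner_nondegenerate) _ _
    rw [← h]
    exact unitMesh.inner_sq_le _ _
  have hdeg : p.natDegree < k + 1 := by
    rcases eq_or_ne p 0 with rfl | h0
    · simp
    · exact (natDegree_lt_iff_degree_lt h0).2 (mem_degreeLT.1 hp)
  rw [eval_eq_sum_range' hdeg, ← hv, mul_assoc, Finset.sum_mul]
  refine sq_sum_le_card_mul_sum_sq.trans ?_
  rw [Finset.card_range]
  push_cast
  refine mul_le_mul_of_nonneg_left (Finset.sum_le_sum fun i _ => ?_) (by positivity)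
  rw [mul_pow]
  refine (mul_le_of_le_one_right (sq_nonneg _) ?_).trans (hc i)
  exact pow_le_one₀ (pow_nonneg hx.1 _) (pow_le_one₀ hx.1 hx.2)

theorem comp_affine_mem_degreeLT {n : ℕ} {p : ℝ[X]} (hp : p ∈ degreeLT ℝ n) (c d : ℝ) :
    p.comp (C c * X + C d) ∈ degreeLT ℝ n := by
  rcases Nat.eq_zero_or_pos n with rfl | hn
  · have : p = 0 := by
      rw [mem_degreeLT] at hp
      exact degree_eq_bot.1 (by simpa using hp)
    simp [this]
  rw [mem_degreeLT]
  rcases eq_or_ne p 0 with rfl | h0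
  · simp
  have h1 : p.natDegree < n := (natDegree_lt_iff_degree_lt h0).2 (mem_degreeLT.1 hp)
  refine (degree_le_natDegree).trans_lt ?_
  have : (p.comp (C c * X + C d)).natDegree ≤ p.natDegree * 1 :=
    natDegree_comp_le.trans (Nat.mul_le_mul_left _ (natDegree_linear_le))
  exact_mod_cast (by omega : (p.comp (C c * X + C d)).natDegree < n)

theorem integral_eval_comp_affine (f : ℝ → ℝ) {l r : ℝ} (h : l < r) :
    ∫ y in (0 : ℝ)..1, f ((r - l) * y + l) = (r - l)⁻¹ * ∫ x in l..r, f x := by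
  rw [intervalIntegral.integral_comp_mul_add f (sub_pos.2 h).ne' l]
  simp

/-- Inverse inequality between the maximum norm and the `L²` norm on a cell. -/
theorem exists_eval_sq_le (k : ℕ) : ∃ C : ℝ, 0 ≤ C ∧ ∀ p ∈ degreeLT ℝ (k + 1),
    ∀ l r : ℝ, l < r → ∀ x ∈ Set.Icc l r,
      p.eval x ^ 2 * (r - l) ≤ C * ∫ y in l..r, p.eval y ^ 2 := by
  obtain ⟨K, hK, H⟩ := exists_eval_sq_le_unit k
  refine ⟨K, hK, fun p hp l r hlr x hx => ?_⟩
  have hpos := sub_pos.2 hlr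
  have h := H _ (comp_affine_mem_degreeLT hp (r - l) l) ((x - l) / (r - l))
    ⟨div_nonneg (by linarith [hx.1]) hpos.le, (div_le_one hpos).2 (by linarith [hx.2])⟩
  simp only [eval_comp, eval_add, eval_mul, eval_C, eval_X] at h
  rw [integral_eval_comp_affine (fun x => p.eval x ^ 2) hlr, mul_div_cancel₀ _ hpos.ne',
    sub_add_cancel] at h
  calc p.eval x ^ 2 * (r - l) ≤ (K * ((r - l)⁻¹ * ∫ y in l..r, p.eval y ^ 2)) * (r - l) :=
        mul_le_mul_of_nonneg_right h hpos.le
    _ = _ := by field_simp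

/-- The functional `q ↦ ∫₀¹ p q` on polynomials of degree less than `n`. -/
noncomputable def unitPairing (k n : ℕ) :
    degreeLT ℝ k →ₗ[ℝ] Module.Dual ℝ (degreeLT ℝ n) :=
  LinearMap.mk₂ ℝ (fun p q => ∫ x in (0 : ℝ)..1, (p : ℝ[X]).eval x * (q : ℝ[X]).eval x)
    (fun p p' q => by
      rw [← intervalIntegral.integral_add (Continuous.intervalIntegrable (by fun_prop) _ _)
        (Continuous.intervalIntegrable (by fun_prop) _ _)]
      simp [add_mul])
    (fun c p q => by
      rw [smul_eq_mul, ← intervalIntegral.integral_const_mul]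
      simp [mul_assoc])
    (fun p q q' => by
      rw [← intervalIntegral.integral_add (Continuous.intervalIntegrable (by fun_prop) _ _)
        (Continuous.intervalIntegrable (by fun_prop) _ _)]
      simp [mul_add])
    (fun c p q => by
      rw [smul_eq_mul, ← intervalIntegral.integral_const_mul]
      simp [mul_left_comm])

/-- Positivity of the weight is asked only on the open interval because the weight needed for
Legendre polynomials, `1 - x`, vanishes at an end point. -/
theorem eval_mul_self_eq_zero_of_integral {p w : ℝ[X]} (hw : ∀ x ∈ Set.Ioo (0 : ℝ) 1, 0 < w.eval x)
    (h : ∫ x in (0 : ℝ)..1, w.eval x * (p.eval x * p.eval x) = 0) : p = 0 := by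
  by_contra hp
  obtain ⟨c, hc, hc0⟩ : ∃ c ∈ Set.Ioo (0 : ℝ) 1, p.eval c ≠ 0 := by
    by_contra! hall
    exact hp (eq_zero_of_infinite_isRoot _ ((Set.Ioo_infinite one_pos).mono fun c hc => hall c hc))
  have hw' : ∀ x ∈ Set.Icc (0 : ℝ) 1, 0 ≤ w.eval x := by
    rw [← closure_Ioo (zero_ne_one)]
    exact fun x hx => closure_minimal (fun y hy => (hw y hy).le)
      (isClosed_le continuous_const w.continuous) hx
  have := intervalIntegral.integral_pos one_pos
    (f := fun x => w.eval x * (p.eval x * p.eval x)) (Continuous.continuousOn (by fun_prop))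
    (fun x hx => mul_nonneg (hw' x ⟨hx.1.le, hx.2⟩) (mul_self_nonneg _))
    ⟨c, Set.Ioo_subset_Icc_self hc, mul_pos (hw c hc) (mul_self_pos.2 hc0)⟩
  exact this.ne' h

theorem derivative_mem_degreeLT {k : ℕ} {p : ℝ[X]} (hp : p ∈ degreeLT ℝ (k + 1)) :
    derivative p ∈ degreeLT ℝ k := by
  rw [mem_degreeLT] at hp ⊢
  rcases eq_or_ne p 0 with rfl | h0
  · simp
  have h1 : p.natDegree < k + 1 := (natDegree_lt_iff_degree_lt h0).2 hp
  rcases eq_or_ne (derivative p) 0 with h | h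
  · rw [h, degree_zero]; exact WithBot.bot_lt_coe _
  · rw [← natDegree_lt_iff_degree_lt h]
    have := natDegree_derivative_le p
    have h2 : p.natDegree ≠ 0 := fun h2 => h (derivative_of_natDegree_zero h2)
    omega

theorem finrank_degreeLT (n : ℕ) : Module.finrank ℝ (degreeLT ℝ n) = n := by
  rw [(degreeLTEquiv ℝ n).finrank_eq, Module.finrank_fin_fun]

/-- The Legendre polynomial of `[0, 1]`, by its characteristic properties. -/
theorem exists_legendre_unit (k : ℕ) : ∃ L ∈ degreeLT ℝ (k + 1), L.eval 1 = 1 ∧ L.eval 0 ^ 2 = 1 ∧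
    ∀ q ∈ degreeLT ℝ k, ∫ x in (0 : ℝ)..1, L.eval x * q.eval x = 0 := by
  -- There are `k` orthogonality conditions on a space of dimension `k + 1`.
  have hker : LinearMap.ker (unitPairing (k + 1) k) ≠ ⊥ := by
    refine LinearMap.ker_ne_bot_of_finrank_lt ?_
    rw [Subspace.dual_finrank_eq, finrank_degreeLT, finrank_degreeLT]
    exact Nat.lt_succ_self k
  obtain ⟨⟨P, hP⟩, hPk, hP0⟩ := (Submodule.ne_bot_iff _).1 hker
  have hP0' : P ≠ 0 := fun h => hP0 (Subtype.ext h)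
  have horth : ∀ q ∈ degreeLT ℝ k, ∫ x in (0 : ℝ)..1, P.eval x * q.eval x = 0 := fun q hq =>
    LinearMap.congr_fun (LinearMap.mem_ker.1 hPk) ⟨q, hq⟩
  -- If `P = (X - 1) Q`, then `Q` is an admissible test function, and orthogonality reads `∫ (1 - x)
  -- Q² = 0`.
  have h1 : P.eval 1 ≠ 0 := by
    intro h
    obtain ⟨Q, rfl⟩ := dvd_iff_isRoot.2 (show P.IsRoot 1 from h)
    have hQ : Q ∈ degreeLT ℝ k := by
      rw [mem_degreeLT] at hP ⊢
      rw [degree_mul, degree_X_sub_C] at hP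
      have hQ0 : Q ≠ 0 := right_ne_zero_of_mul hP0'
      rw [degree_eq_natDegree hQ0] at hP ⊢
      have : 1 + Q.natDegree < k + 1 := by exact_mod_cast hP
      exact_mod_cast (by omega : Q.natDegree < k)
    have := horth Q hQ
    apply right_ne_zero_of_mul hP0'
    refine eval_mul_self_eq_zero_of_integral (w := C 1 - X) (fun x hx => ?_) ?_
    · simp only [eval_sub, eval_C, eval_X]; linarith [hx.2]
    · rw [← neg_eq_zero, ← intervalIntegral.integral_neg, ← this]
      congr 1
      funext x
      simp only [eval_sub, eval_C, eval_X, eval_mul]; ring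
  -- `P` is orthogonal to `P'`, and `2 ∫ P P'` is the difference of the end-point values of `P²`.
  have h01 : P.eval 0 ^ 2 = P.eval 1 ^ 2 := by
    have := horth _ (derivative_mem_degreeLT hP)
    have hibp := intervalIntegral.integral_mul_deriv_eq_deriv_mul (a := 0) (b := 1)
      (fun x _ => P.hasDerivAt x) (fun x _ => P.hasDerivAt x)
      (Continuous.intervalIntegrable (by fun_prop) _ _)
      (Continuous.intervalIntegrable (by fun_prop) _ _)
    have h3 : ∫ x in (0 : ℝ)..1, (derivative P).eval x * P.eval x = 0 := by
      simpa only [mul_comm] using this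
    rw [this, h3] at hibp
    nlinarith
  refine ⟨(P.eval 1)⁻¹ • P, Submodule.smul_mem _ _ hP, ?_, ?_, fun q hq => ?_⟩
  · simp [h1]
  · simp only [eval_smul, smul_eq_mul, mul_pow, h01]
    field_simp
  · simp only [eval_smul, smul_eq_mul, mul_assoc, intervalIntegral.integral_const_mul, horth q hq,
      mul_zero]

/-- Legendre polynomials on arbitrary cells, normalized at the right end point. -/
theorem exists_legendre (k : ℕ) : ∃ ε Λ : ℝ, ε ^ 2 = 1 ∧ 0 ≤ Λ ∧ ∀ l r : ℝ, l < r →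
    ∃ L ∈ degreeLT ℝ (k + 1), L.eval r = 1 ∧ L.eval l = ε ∧
      (∀ q ∈ degreeLT ℝ k, ∫ x in l..r, L.eval x * q.eval x = 0) ∧
      ∫ x in l..r, L.eval x ^ 2 = Λ * (r - l) := by
  obtain ⟨L, hL, h1, h0, horth⟩ := exists_legendre_unit k
  -- Both constants are read off on the unit cell. Since `ε` is the same on every cell, the flux
  -- system in `exists_gaussRadau` has constant coefficients on any mesh.
  refine ⟨L.eval 0, ∫ x in (0 : ℝ)..1, L.eval x ^ 2, h0,
    intervalIntegral.integral_nonneg zero_le_one fun x _ => sq_nonneg _, fun l r hlr => ?_⟩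
  have hpos := sub_pos.2 hlr
  have hne := hpos.ne'
  have hev : ∀ y, (L.comp (C (r - l)⁻¹ * X + C (-l / (r - l)))).eval ((r - l) * y + l) = L.eval y :=
    fun y => by
      simp only [eval_comp, eval_add, eval_mul, eval_C, eval_X]
      congr 1
      field_simp
      ring
  refine ⟨L.comp (C (r - l)⁻¹ * X + C (-l / (r - l))), comp_affine_mem_degreeLT hL _ _, ?_, ?_,
    fun q hq => ?_, ?_⟩
  · rw [← h1, ← hev 1]; congr 1; ring
  · rw [← hev 0]; congr 1; ring
  · have h := horth _ (comp_affine_mem_degreeLT hq (r - l) l)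
    have h2 := integral_eval_comp_affine
      (fun x => (L.comp (C (r - l)⁻¹ * X + C (-l / (r - l)))).eval x * q.eval x) hlr
    simp only [hev] at h2
    simp only [eval_comp (p := q), eval_add, eval_mul, eval_C, eval_X] at h
    rw [h] at h2
    simpa [hne] using h2.symm
  · have h2 := integral_eval_comp_affine
      (fun x => (L.comp (C (r - l)⁻¹ * X + C (-l / (r - l)))).eval x ^ 2) hlr
    simp only [hev] at h2
    rw [h2]
    field_simp

/-- Cauchy-Schwarz inequality `(∫ |g|)² ≤ (r - l) ∫ g²`. -/
theorem sq_integral_abs_le {g : ℝ → ℝ} {l r : ℝ} (hlr : l < r)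
    (hg : IntervalIntegrable g volume l r)
    (hg2 : IntervalIntegrable (fun x => g x ^ 2) volume l r) :
    (∫ x in l..r, |g x|) ^ 2 ≤ (r - l) * ∫ x in l..r, g x ^ 2 := by
  have hpos := sub_pos.2 hlr
  set A := ∫ x in l..r, |g x| with hA
  set c := A / (r - l) with hc
  -- The integrand is `(|g| - c)²`, with `c` the mean of `|g|`.
  have h0 : 0 ≤ ∫ x in l..r, (g x ^ 2 - 2 * c * |g x| + c ^ 2) :=
    intervalIntegral.integral_nonneg hlr.le fun x _ => by
      nlinarith [sq_nonneg (|g x| - c), sq_abs (g x)]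
  rw [intervalIntegral.integral_add (hg2.sub (hg.abs.const_mul _)) intervalIntegrable_const,
    intervalIntegral.integral_sub hg2 (hg.abs.const_mul _),
    intervalIntegral.integral_const_mul, intervalIntegral.integral_const, ← hA, smul_eq_mul] at h0
  have hcA : c * (r - l) = A := div_mul_cancel₀ _ hpos.ne'
  have h1 : A * c ≤ ∫ x in l..r, g x ^ 2 := by
    have h2 : (r - l) * c ^ 2 = c * A := by rw [← hcA]; ring
    linarith
  calc A ^ 2 = (r - l) * (A * c) := by rw [← hcA]; ring
    _ ≤ _ := mul_le_mul_of_nonneg_left h1 hpos.le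

theorem exists_antiderivative {n : ℕ} {p : ℝ[X]} (hp : p ∈ degreeLT ℝ n) :
    ∃ P ∈ degreeLT ℝ (n + 1), derivative P = p := by
  refine ⟨∑ i ∈ Finset.range n, C (p.coeff i / (i + 1)) * X ^ (i + 1),
    Submodule.sum_mem _ fun i hi => ?_, ?_⟩
  · rw [mem_degreeLT]
    refine (degree_C_mul_X_pow_le _ _).trans_lt ?_
    exact_mod_cast Nat.succ_lt_succ (Finset.mem_range.1 hi)
  · rw [derivative_sum]
    rcases eq_or_ne p 0 with rfl | h0
    · simp
    conv_rhs =>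
      rw [p.as_sum_range' n ((natDegree_lt_iff_degree_lt h0).2 (mem_degreeLT.1 hp))]
    refine Finset.sum_congr rfl fun i _ => ?_
    rw [derivative_C_mul_X_pow, Nat.add_sub_cancel, C_mul_X_pow_eq_monomial]
    congr 1
    push_cast
    field_simp

/-- Approximation by polynomials on an interval, for functions whose derivative of order `n` is
absolutely continuous. -/
theorem exists_polynomial_approx {l r : ℝ} (hlr : l < r) (n : ℕ) : ∀ f : ℝ → ℝ, ContDiff ℝ n f →
    AbsolutelyContinuousOnInterval (iteratedDeriv n f) l r →
    ∃ T ∈ degreeLT ℝ (n + 1), ∀ x ∈ Set.Icc l r,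
      |f x - T.eval x| ≤ (r - l) ^ n * ∫ y in l..r, |iteratedDeriv (n + 1) f y| := by
  induction n with
  | zero =>
    intro f _ hac
    rw [iteratedDeriv_zero] at hac
    refine ⟨C (f l), mem_degreeLT.2 (degree_C_le.trans_lt (by norm_num)), fun x hx => ?_⟩
    have hsub : Set.uIcc l x ⊆ Set.uIcc l r := by
      rw [Set.uIcc_of_le hx.1, Set.uIcc_of_le hlr.le]
      exact Set.Icc_subset_Icc_right hx.2
    rw [eval_C, ← (hac.mono hsub).integral_deriv_eq_sub, pow_zero, one_mul, zero_add,
      iteratedDeriv_one]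
    refine (intervalIntegral.abs_integral_le_integral_abs hx.1).trans ?_
    exact intervalIntegral.integral_mono_interval le_rfl hx.1 hx.2
      (Filter.Eventually.of_forall fun y => abs_nonneg _) hac.intervalIntegrable_deriv.abs
  | succ n ih =>
    intro f hf hac
    have hf1 : ContDiff ℝ n (deriv f) := by
      have : ContDiff ℝ ((n : WithTop ℕ∞) + 1) f := by exact_mod_cast hf
      exact (contDiff_succ_iff_deriv.1 this).2.2
    have hdiff : Differentiable ℝ f := hf.differentiable (by simp)
    rw [iteratedDeriv_succ'] at hac
    obtain ⟨T, hT, hTb⟩ := ih (deriv f) hf1 hac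
    obtain ⟨P, hP, hPT⟩ := exists_antiderivative hT
    -- Integrating the approximant of `f'` and matching `f` at `l` gains one factor `r - l`.
    refine ⟨P + C (f l - P.eval l), Submodule.add_mem _ hP
      (mem_degreeLT.2 (degree_C_le.trans_lt (by exact_mod_cast Nat.succ_pos _))), fun x hx => ?_⟩
    rw [iteratedDeriv_succ']
    set B := (r - l) ^ n * ∫ y in l..r, |iteratedDeriv (n + 1) (deriv f) y| with hB
    have hB0 : 0 ≤ B := (abs_nonneg _).trans (hTb l ⟨le_rfl, hlr.le⟩)
    have hcont : Continuous fun y => deriv f y - T.eval y := hf1.continuous.sub T.continuous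
    have hzInt : ∫ y in l..x, (deriv f y - T.eval y) =
        (f x - P.eval x) - (f l - P.eval l) :=
      intervalIntegral.integral_eq_sub_of_hasDerivAt (f := fun y => f y - P.eval y)
        (fun y _ => (hdiff y).hasDerivAt.sub (hPT ▸ P.hasDerivAt y))
        (hcont.intervalIntegrable _ _)
    have hle : ‖∫ y in l..x, (deriv f y - T.eval y)‖ ≤ B * |x - l| :=
      intervalIntegral.norm_integral_le_of_norm_le_const fun y hy => by
        rw [Set.uIoc_of_le hx.1] at hy
        exact hTb y ⟨hy.1.le, hy.2.trans hx.2⟩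
    rw [hzInt, Real.norm_eq_abs, abs_of_nonneg (sub_nonneg.2 hx.1)] at hle
    have heq : f x - (P + C (f l - P.eval l)).eval x = (f x - P.eval x) - (f l - P.eval l) := by
      simp only [eval_add, eval_C]; ring
    rw [heq]
    calc _ ≤ B * (x - l) := hle
      _ ≤ B * (r - l) := mul_le_mul_of_nonneg_left (by linarith [hx.2]) hB0
      _ = _ := by rw [hB, pow_succ]; ring

end LDG

/-! ### Cells, piecewise polynomials as functions, and the `L²` projection -/

namespace LDG.Mesh

variable {a b : ℝ} {N k : ℕ} (M : Mesh a b N)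

theorem le_left (j : Fin N) : a ≤ M.left j :=
  M.node_zero.symm.le.trans (M.strictMono_node.monotone (Fin.zero_le _))

theorem right_le (j : Fin N) : M.right j ≤ b :=
  (M.strictMono_node.monotone (Fin.le_last _)).trans M.node_last.le

theorem width_pos (j : Fin N) : 0 < M.width j := sub_pos.2 (M.left_lt_right j)

theorem width_le_size [NeZero N] (j : Fin N) : M.width j ≤ M.size :=
  Finset.le_sup' M.width (Finset.mem_univ j)

theorem size_pos [NeZero N] : 0 < M.size := (M.width_pos 0).trans_le (M.width_le_size 0)

theorem size_le [NeZero N] : M.size ≤ b - a :=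
  Finset.sup'_le _ _ fun j _ => sub_le_sub (M.right_le j) (M.le_left j)

theorem Icc_cell_subset (j : Fin N) : Set.Icc (M.left j) (M.right j) ⊆ Set.Icc a b :=
  Set.Icc_subset_Icc (M.le_left j) (M.right_le j)

/-- For the last cell, `j + 1` wraps around to the first one, and the equality is the periodicity `u
a = u b`. For the others the two nodes coincide. -/
theorem right_eq_left_succ [NeZero N] {u : ℝ → ℝ} (hu : u a = u b) (j : Fin N) :
    u (M.right j) = u (M.left (j + 1)) := by
  obtain ⟨n, rfl⟩ : ∃ n, N = n + 1 := Nat.exists_eq_succ_of_ne_zero (NeZero.ne N)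
  rcases eq_or_ne j (Fin.last n) with rfl | h
  · have h1 : M.right (Fin.last n) = b := M.node_last
    have h2 : M.left (Fin.last n + 1) = a := by
      rw [Fin.last_add_one]; exact M.node_zero
    rw [h1, h2, hu]
  · have : (j + 1).castSucc = j.succ := by
      ext
      rw [Fin.val_castSucc, Fin.val_succ, Fin.val_add_one_of_lt (Fin.lt_last_iff_ne_last.2 h)]
    rw [left, right, this]

/-- Indexing by `ℕ` matches the lemmas on sums of integrals over adjacent intervals; the values
beyond `N` play no role. -/
theorem exists_nodeSeq : ∃ x : ℕ → ℝ, x 0 = a ∧ x N = b ∧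
    (∀ j : Fin N, x j = M.left j) ∧ ∀ j : Fin N, x (j + 1) = M.right j := by
  refine ⟨fun i => if h : i < N + 1 then M.node ⟨i, h⟩ else b, ?_, ?_, fun j => ?_, fun j => ?_⟩
  · simp only [dif_pos (Nat.succ_pos N)]; exact M.node_zero
  · simp only [dif_pos (Nat.lt_succ_self N)]; exact M.node_last
  · simp only [dif_pos (show (j : ℕ) < N + 1 by omega)]; rfl
  · simp only [dif_pos (show (j : ℕ) + 1 < N + 1 by omega)]; rfl

theorem sum_integral_cells {f : ℝ → ℝ} (hf : IntervalIntegrable f volume a b) :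
    ∑ j, ∫ x in M.left j..M.right j, f x = ∫ x in a..b, f x := by
  obtain ⟨x, h0, hN, hl, hr⟩ := M.exists_nodeSeq
  have h := intervalIntegral.sum_integral_adjacent_intervals (f := f) (μ := volume) (a := x)
    (n := N) fun i hi => by
      have := M.intervalIntegrable_cell hf ⟨i, hi⟩
      rwa [← hl, ← hr] at this
  rw [h0, hN] at h
  rw [← h, ← Fin.sum_univ_eq_sum_range (fun i => ∫ y in x i..x (i + 1), f y) N]
  exact Finset.sum_congr rfl fun j _ => by rw [hl, hr]

theorem toFun_eq (v : DGSpace N k) {j : Fin N} {x : ℝ}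
    (hx : x ∈ Set.Ico (M.left j) (M.right j)) : M.toFun v x = (v j : ℝ[X]).eval x := by
  rw [toFun, Finset.sum_eq_single j, Set.indicator_of_mem hx]
  · intro i _ hij
    refine Set.indicator_of_notMem (fun hi => ?_) _
    rcases lt_or_gt_of_ne hij with h | h
    · have : M.right i ≤ M.left j := M.strictMono_node.monotone (Fin.succ_le_castSucc_iff.2 h)
      linarith [hi.2, hx.1]
    · have : M.right j ≤ M.left i := M.strictMono_node.monotone (Fin.succ_le_castSucc_iff.2 h)
      linarith [hi.1, hx.2]
  · simp

theorem integral_toFun_congr (F : ℝ → ℝ → ℝ) (v : DGSpace N k) (j : Fin N) :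
    ∫ x in M.left j..M.right j, F x (M.toFun v x) =
      ∫ x in M.left j..M.right j, F x ((v j : ℝ[X]).eval x) := by
  refine intervalIntegral.integral_congr_uIoo fun x hx => ?_
  rw [Set.uIoo_of_le (M.left_lt_right j).le] at hx
  simp only [M.toFun_eq v (Set.Ioo_subset_Ico_self hx)]

theorem integrable_toFun_comp {F : ℝ → ℝ → ℝ} (v : DGSpace N k)
    (hF : ∀ p : ℝ[X], IntervalIntegrable (fun x => F x (p.eval x)) volume a b) :
    IntervalIntegrable (fun x => F x (M.toFun v x)) volume a b := by
  obtain ⟨x, h0, hN, hl, hr⟩ := M.exists_nodeSeq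
  have h : IntervalIntegrable (fun x => F x (M.toFun v x)) volume (x 0) (x N) := by
    refine IntervalIntegrable.trans_iterate fun i hi => ?_
    have h1 := hl ⟨i, hi⟩
    have h2 := hr ⟨i, hi⟩
    simp only at h1 h2
    rw [h1, h2]
    refine (M.intervalIntegrable_cell (hF (v ⟨i, hi⟩)) ⟨i, hi⟩).congr_uIoo fun y hy => ?_
    rw [Set.uIoo_of_le (M.left_lt_right _).le] at hy
    simp only [M.toFun_eq v (Set.Ioo_subset_Ico_self hy)]
  rwa [h0, hN] at h

theorem inner_proj₀ {f : ℝ → ℝ} (hf : IntervalIntegrable f volume a b) (v : DGSpace N k) :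
    M.inner (M.proj₀ k f) v = ∑ j, ∫ x in M.left j..M.right j, f x * (v j : ℝ[X]).eval x := by
  rw [proj₀, dif_pos hf]
  exact LinearMap.BilinForm.apply_toDual_symm_apply (hB := M.inner_nondegenerate) _ _

theorem integral_proj₀_mul {f : ℝ → ℝ} (hf : IntervalIntegrable f volume a b) (j : Fin N)
    {p : ℝ[X]} (hp : p ∈ degreeLT ℝ (k + 1)) :
    ∫ x in M.left j..M.right j, (M.proj₀ k f j : ℝ[X]).eval x * p.eval x =
      ∫ x in M.left j..M.right j, f x * p.eval x := by
  -- A test function supported on one cell belongs to `V_h`, so the projection is local.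
  have h := M.inner_proj₀ hf (Pi.single j (⟨p, hp⟩ : degreeLT ℝ (k + 1)))
  rw [inner_apply, Finset.sum_eq_single j, Finset.sum_eq_single j] at h
  · simpa using h
  all_goals simp +contextual [Pi.single_eq_of_ne]

theorem ext_inner {v w : DGSpace N k} (h : ∀ z, M.inner v z = M.inner w z) : v = w := by
  rw [← sub_eq_zero]
  refine M.inner_self_eq_zero ?_
  rw [LinearMap.map_sub₂, h, sub_self]

/-- The squared `L²` distance between `f` and an element of `V_h`. -/
noncomputable def errSq (f : ℝ → ℝ) (v : DGSpace N k) : ℝ :=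
  ∑ j, ∫ x in M.left j..M.right j, (f x - (v j : ℝ[X]).eval x) ^ 2

theorem le {a b : ℝ} {N : ℕ} (M : Mesh a b N) : a ≤ b :=
  M.node_zero.symm.le.trans ((M.strictMono_node.monotone (Fin.zero_le _)).trans M.node_last.le)

theorem intervalIntegrable_of_continuousOn {a b : ℝ} {N : ℕ} (M : Mesh a b N) {f : ℝ → ℝ}
    (hf : ContinuousOn f (Set.Icc a b)) :
    IntervalIntegrable f volume a b :=
  ContinuousOn.intervalIntegrable (by rwa [Set.uIcc_of_le M.le])

theorem continuousOn_cell {f : ℝ → ℝ} (hf : ContinuousOn f (Set.Icc a b)) (j : Fin N) :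
    ContinuousOn f (Set.uIcc (M.left j) (M.right j)) := by
  rw [Set.uIcc_of_le (M.left_lt_right j).le]
  exact hf.mono (M.Icc_cell_subset j)

/-- The Pythagorean theorem on a cell for the `L²` projection. -/
theorem integral_sq_sub_eq_add {f : ℝ → ℝ} (hf : ContinuousOn f (Set.Icc a b)) (j : Fin N)
    {p : ℝ[X]} (hp : p ∈ degreeLT ℝ (k + 1)) :
    ∫ x in M.left j..M.right j, (f x - p.eval x) ^ 2 =
      (∫ x in M.left j..M.right j, (f x - (M.proj₀ k f j : ℝ[X]).eval x) ^ 2) +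
        ∫ x in M.left j..M.right j, (p - (M.proj₀ k f j : ℝ[X])).eval x ^ 2 := by
  set P := M.proj₀ k f with hP
  have hc := M.continuousOn_cell hf j
  have horth := M.integral_proj₀_mul (M.intervalIntegrable_of_continuousOn hf) j
    (Submodule.sub_mem _ hp (P j).2)
  have h1 : IntervalIntegrable (fun x => (f x - (P j : ℝ[X]).eval x) ^ 2) volume
      (M.left j) (M.right j) :=
    ContinuousOn.intervalIntegrable ((hc.sub (Polynomial.continuous _).continuousOn).pow 2)
  have h2 : IntervalIntegrable (fun x => (p - (P j : ℝ[X])).eval x ^ 2) volume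
      (M.left j) (M.right j) := Continuous.intervalIntegrable (by fun_prop) _ _
  have h3 : IntervalIntegrable (fun x => f x * (p - (P j : ℝ[X])).eval x) volume
      (M.left j) (M.right j) :=
    ContinuousOn.intervalIntegrable (hc.mul (Polynomial.continuous _).continuousOn)
  have h4 : IntervalIntegrable (fun x => (P j : ℝ[X]).eval x * (p - (P j : ℝ[X])).eval x) volume
      (M.left j) (M.right j) := Continuous.intervalIntegrable (by fun_prop) _ _
  have key : ∀ x, (f x - p.eval x) ^ 2 = (f x - (P j : ℝ[X]).eval x) ^ 2 +
      (p - (P j : ℝ[X])).eval x ^ 2 - 2 * (f x * (p - (P j : ℝ[X])).eval x -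
        (P j : ℝ[X]).eval x * (p - (P j : ℝ[X])).eval x) := fun x => by
    simp only [eval_sub]; ring
  simp only [key]
  rw [intervalIntegral.integral_sub (h1.add h2) ((h3.sub h4).const_mul 2),
    intervalIntegral.integral_add h1 h2, intervalIntegral.integral_const_mul,
    intervalIntegral.integral_sub h3 h4, horth]
  ring

/-- Used in both directions: any good approximant bounds the error of `Π₀ f`, and it is itself close
to `Π₀ f`. -/
theorem errSq_eq_add {f : ℝ → ℝ} (hf : ContinuousOn f (Set.Icc a b)) (v : DGSpace N k) :
    M.errSq f v = M.errSq f (M.proj₀ k f) + M.inner (v - M.proj₀ k f) (v - M.proj₀ k f) := by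
  rw [errSq, errSq, inner_apply, ← Finset.sum_add_distrib]
  refine Finset.sum_congr rfl fun j _ => ?_
  rw [M.integral_sq_sub_eq_add hf j (v j).2]
  simp [sq]

theorem errSq_nonneg (f : ℝ → ℝ) (v : DGSpace N k) : 0 ≤ M.errSq f v :=
  Finset.sum_nonneg fun j _ => intervalIntegral.integral_nonneg (M.left_lt_right j).le
    fun _ _ => sq_nonneg _

/-- The `L²` projection is quasi-optimal in the maximum norm of each cell. -/
theorem exists_sq_sub_proj₀_le (k : ℕ) : ∃ B : ℝ, 0 ≤ B ∧ ∀ {a b : ℝ} {N : ℕ} (M : Mesh a b N)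
    (f : ℝ → ℝ), ContinuousOn f (Set.Icc a b) → ∀ (j : Fin N) (d : ℝ),
    ∀ T ∈ degreeLT ℝ (k + 1), (∀ x ∈ Set.Icc (M.left j) (M.right j), (f x - T.eval x) ^ 2 ≤ d) →
      ∀ x ∈ Set.Icc (M.left j) (M.right j), (f x - (M.proj₀ k f j : ℝ[X]).eval x) ^ 2 ≤ B * d := by
  obtain ⟨K, hK, H⟩ := exists_eval_sq_le k
  -- From `(f - P)² ≤ 2 (f - T)² + 2 (T - P)²`. The inverse inequality turns a pointwise value of `T
  -- - P` into its `L²` norm, which Pythagoras bounds by that of `f - T`.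
  refine ⟨2 + 2 * K, by positivity, fun M f hf j d T hT hd x hx => ?_⟩
  set P := M.proj₀ k f with hP
  have hw := M.left_lt_right j
  have h1 := H _ (Submodule.sub_mem _ hT (P j).2) _ _ hw x hx
  have h2 := M.integral_sq_sub_eq_add hf j hT
  have h3 : 0 ≤ ∫ x in M.left j..M.right j, (f x - (P j : ℝ[X]).eval x) ^ 2 :=
    intervalIntegral.integral_nonneg hw.le fun _ _ => sq_nonneg _
  have h4 : ∫ x in M.left j..M.right j, (f x - T.eval x) ^ 2 ≤
      ∫ x in M.left j..M.right j, d :=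
    intervalIntegral.integral_mono_on hw.le (ContinuousOn.intervalIntegrable
      (((M.continuousOn_cell hf j).sub (Polynomial.continuous _).continuousOn).pow 2))
      intervalIntegrable_const hd
  rw [intervalIntegral.integral_const, smul_eq_mul] at h4
  have h5 : (T - (P j : ℝ[X])).eval x ^ 2 ≤ K * d := by
    refine le_of_mul_le_mul_right (h1.trans ?_) (sub_pos.2 hw)
    calc _ ≤ K * ((M.right j - M.left j) * d) := mul_le_mul_of_nonneg_left (by linarith) hK
      _ = _ := by ring
  have h6 := hd x hx
  rw [eval_sub] at h5
  nlinarith [sq_nonneg ((f x - T.eval x) - (T.eval x - (P j : ℝ[X]).eval x))]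

/-! ### Cyclic two-term systems and the generalized Gauss-Radau projection -/

theorem sum_comp_add_one {N : ℕ} [NeZero N] (f : Fin N → ℝ) : ∑ j, f (j + 1) = ∑ j, f j :=
  Equiv.sum_comp (Equiv.addRight (1 : Fin N)) f

/-- The cross term is at least `-|s| |t| (c_j² + c_{j+1}²)`, and the cyclic sum of `c_{j+1}²` equals
that of `c_j²`. The constant is free of `N`. -/
theorem circulant_lower_bound {N : ℕ} [NeZero N] (s t : ℝ) (c : Fin N → ℝ) :
    (|s| - |t|) ^ 2 * ∑ j, c j ^ 2 ≤ ∑ j, (s * c j + t * c (j + 1)) ^ 2 := by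
  have h : ∀ j, s ^ 2 * c j ^ 2 + t ^ 2 * c (j + 1) ^ 2 - |s| * |t| * (c j ^ 2 + c (j + 1) ^ 2) ≤
      (s * c j + t * c (j + 1)) ^ 2 := fun j => by
    have h1 : -(|s| * |t| * (|c j| * |c (j + 1)|)) ≤ s * t * (c j * c (j + 1)) := by
      rw [← abs_mul, ← abs_mul, ← abs_mul]; exact neg_abs_le _
    have h2 : 2 * (|c j| * |c (j + 1)|) ≤ c j ^ 2 + c (j + 1) ^ 2 := by
      nlinarith [sq_nonneg (|c j| - |c (j + 1)|), sq_abs (c j), sq_abs (c (j + 1))]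
    nlinarith [mul_le_mul_of_nonneg_left h2 (mul_nonneg (abs_nonneg s) (abs_nonneg t))]
  refine le_trans (le_of_eq ?_) (Finset.sum_le_sum fun j _ => h j)
  rw [Finset.sum_sub_distrib, Finset.sum_add_distrib, ← Finset.mul_sum, ← Finset.mul_sum,
    ← Finset.mul_sum, Finset.sum_add_distrib, sum_comp_add_one (fun j => c j ^ 2)]
  rw [sub_sq, sq_abs, sq_abs]
  ring

/-- The lower bound gives injectivity, hence surjectivity in finite dimension, and then stability of
the solution. -/
theorem exists_circulant_solution {N : ℕ} [NeZero N] {s t : ℝ} (hst : |s| ≠ |t|)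
    (g : Fin N → ℝ) : ∃ c : Fin N → ℝ, (∀ j, s * c j + t * c (j + 1) = g j) ∧
      (|s| - |t|) ^ 2 * ∑ j, c j ^ 2 ≤ ∑ j, g j ^ 2 := by
  let A : (Fin N → ℝ) →ₗ[ℝ] (Fin N → ℝ) :=
    { toFun := fun c j => s * c j + t * c (j + 1)
      map_add' := fun c c' => by funext j; simp only [Pi.add_apply]; ring
      map_smul' := fun r c => by
        funext j; simp only [Pi.smul_apply, smul_eq_mul, RingHom.id_apply]; ring }
  have hinj : Function.Injective A := by
    rw [injective_iff_map_eq_zero]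
    intro c hc
    have h := circulant_lower_bound s t c
    have h0 : ∀ j, s * c j + t * c (j + 1) = 0 := fun j => congrFun hc j
    simp only [h0] at h
    have hpos : 0 < (|s| - |t|) ^ 2 := by have := sub_ne_zero.2 hst; positivity
    have hsum : ∑ j, c j ^ 2 ≤ 0 := by
      by_contra! hlt
      have := mul_pos hpos hlt
      simp at h
      linarith
    have h1 := (Finset.sum_eq_zero_iff_of_nonneg fun j _ => sq_nonneg (c j)).1
      (le_antisymm hsum (Finset.sum_nonneg fun j _ => sq_nonneg _))
    funext j
    exact pow_eq_zero_iff two_ne_zero |>.1 (h1 j (Finset.mem_univ j))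
  obtain ⟨c, hc⟩ := LinearMap.injective_iff_surjective.1 hinj g
  have hc' : ∀ j, s * c j + t * c (j + 1) = g j := fun j => congrFun hc j
  refine ⟨c, hc', ?_⟩
  have := circulant_lower_bound s t c
  simpa only [hc'] using this

/-- This is how the exclusion of `θ = 1/2` enters the analysis. -/
theorem abs_ne_abs_one_sub {t : ℝ} (ht : t ≠ 1 / 2) : |t| ≠ |1 - t| := by
  intro h
  rcases abs_eq_abs.1 h with h | h
  · exact ht (by linarith)
  · linarith

/-- The generalized Gauss-Radau projection: existence and quasi-optimality. -/
theorem exists_gaussRadau (k : ℕ) {t : ℝ} (ht : t ≠ 1 / 2) : ∃ K : ℝ, 0 ≤ K ∧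
    ∀ {a b : ℝ} {N : ℕ} [NeZero N] (M : Mesh a b N) (u : ℝ → ℝ), ContinuousOn u (Set.Icc a b) →
    u a = u b → ∃ p : DGSpace N k,
      (∀ j, ∀ q ∈ degreeLT ℝ k, ∫ x in M.left j..M.right j, (p j : ℝ[X]).eval x * q.eval x =
        ∫ x in M.left j..M.right j, u x * q.eval x) ∧
      (∀ j, M.flux t j p = u (M.right j)) ∧
      ∀ d : Fin N → ℝ, (∀ j, ∃ T ∈ degreeLT ℝ (k + 1),
        ∀ x ∈ Set.Icc (M.left j) (M.right j), (u x - T.eval x) ^ 2 ≤ d j) →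
        M.errSq u p ≤ K * M.size * ∑ j, d j := by
  obtain ⟨B, hB, H⟩ := exists_sq_sub_proj₀_le k
  obtain ⟨ε, Λ, hε, hΛ, HL⟩ := exists_legendre k
  have hε' : |ε| = 1 := by rw [← Real.sqrt_sq_eq_abs, hε, Real.sqrt_one]
  have hts : |t| ≠ |(1 - t) * ε| := by
    rw [abs_mul, hε', mul_one]; exact abs_ne_abs_one_sub ht
  set κ := (|t| - |(1 - t) * ε|) ^ 2 with hκ
  have hκ0 : 0 < κ := by have := sub_ne_zero.2 hts; positivity
  refine ⟨2 * B + 2 * Λ * (2 * (t ^ 2 + (1 - t) ^ 2) * B / κ), by positivity,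
    fun {a b N} _ M u hu hper => ?_⟩
  choose L hL hLr hLl hLorth hLsq using fun j => HL _ _ (M.left_lt_right j)
  set P := M.proj₀ k u with hP
  -- Adding `c_j L_j` to `Π₀ u` keeps the moments against degree less than `k`. Since `L_j` is `1`
  -- at the right end of its cell and `ε` at the left, it changes the flux by `t c_j + (1 - t) ε
  -- c_{j+1}`.
  obtain ⟨c, hc, hcb⟩ := exists_circulant_solution hts (fun j => u (M.right j) - M.flux t j P)
  have hui := M.intervalIntegrable_of_continuousOn hu
  let p : DGSpace N k := fun j => P j + c j • ⟨L j, hL j⟩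
  have hp : ∀ j x, (p j : ℝ[X]).eval x = (P j : ℝ[X]).eval x + c j * (L j).eval x := fun j x => by
    simp [p]
  refine ⟨p, fun j q hq => ?_, fun j => ?_, fun d hd => ?_⟩
  · have hq' : q ∈ degreeLT ℝ (k + 1) := degreeLT_mono (Nat.le_succ k) hq
    rw [← M.integral_proj₀_mul hui j hq']
    simp only [hp, add_mul, mul_assoc]
    rw [intervalIntegral.integral_add (Continuous.intervalIntegrable (by fun_prop) _ _)
      (Continuous.intervalIntegrable (by fun_prop) _ _), intervalIntegral.integral_const_mul,
      hLorth j q hq, mul_zero, add_zero]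
  · have := hc j
    simp only [flux, traceMinus, tracePlus, hp, hLr, hLl] at this ⊢
    linarith
  · choose T hT hTd using hd
    have hPd := fun j => H M u hu j (d j) (T j) (hT j) (hTd j)
    have hd0 : ∀ j, 0 ≤ d j := fun j =>
      (sq_nonneg _).trans (hTd j _ (Set.left_mem_Icc.2 (M.left_lt_right j).le))
    -- The weights of the flux sum to `1`, so its defect is a combination of the errors of `Π₀ u` on
    -- the two sides of the node.
    have hg : ∀ j, (u (M.right j) - M.flux t j P) ^ 2 ≤
        2 * t ^ 2 * B * d j + 2 * (1 - t) ^ 2 * B * d (j + 1) := fun j => by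
      have h1 := hPd j _ (Set.right_mem_Icc.2 (M.left_lt_right j).le)
      have h2 := hPd (j + 1) _ (Set.left_mem_Icc.2 (M.left_lt_right (j + 1)).le)
      rw [← M.right_eq_left_succ hper j] at h2
      have h3 : u (M.right j) - M.flux t j P =
          t * (u (M.right j) - (P j : ℝ[X]).eval (M.right j)) +
          (1 - t) * (u (M.right j) - (P (j + 1) : ℝ[X]).eval (M.left (j + 1))) := by
        simp only [flux, traceMinus, tracePlus]; ring
      rw [h3]
      have h4 := mul_le_mul_of_nonneg_left h1 (sq_nonneg t)
      have h5 := mul_le_mul_of_nonneg_left h2 (sq_nonneg (1 - t))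
      refine add_sq_le.trans ?_
      rw [mul_pow, mul_pow]
      linarith
    have hgs : ∑ j, (u (M.right j) - M.flux t j P) ^ 2 ≤
        2 * (t ^ 2 + (1 - t) ^ 2) * B * ∑ j, d j := by
      refine (Finset.sum_le_sum fun j _ => hg j).trans (le_of_eq ?_)
      rw [Finset.sum_add_distrib, ← Finset.mul_sum, ← Finset.mul_sum, sum_comp_add_one]
      ring
    have hcs : ∑ j, c j ^ 2 ≤ 2 * (t ^ 2 + (1 - t) ^ 2) * B / κ * ∑ j, d j := by
      rw [div_mul_eq_mul_div, le_div_iff₀ hκ0, mul_comm]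
      exact hcb.trans hgs
    have hcell : ∀ j, ∫ x in M.left j..M.right j, (u x - (p j : ℝ[X]).eval x) ^ 2 ≤
        M.size * (2 * B * d j + 2 * Λ * c j ^ 2) := fun j => by
      have hlr := (M.left_lt_right j).le
      have hi : IntervalIntegrable (fun x => 2 * c j ^ 2 * (L j).eval x ^ 2) volume
        (M.left j) (M.right j) := Continuous.intervalIntegrable (by fun_prop) _ _
      calc _ ≤ ∫ x in M.left j..M.right j, (2 * (B * d j) + 2 * c j ^ 2 * (L j).eval x ^ 2) := by
            refine intervalIntegral.integral_mono_on hlr (ContinuousOn.intervalIntegrable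
              (((M.continuousOn_cell hu j).sub (Polynomial.continuous _).continuousOn).pow 2))
              (intervalIntegrable_const.add hi) fun x hx => ?_
            have h1 := hPd j x hx
            rw [hp]
            nlinarith [sq_nonneg ((u x - (P j : ℝ[X]).eval x) + c j * (L j).eval x)]
        _ = M.width j * (2 * B * d j + 2 * Λ * c j ^ 2) := by
            rw [intervalIntegral.integral_add intervalIntegrable_const hi,
              intervalIntegral.integral_const, intervalIntegral.integral_const_mul, hLsq, width,
              smul_eq_mul]
            ring
        _ ≤ _ := mul_le_mul_of_nonneg_right (M.width_le_size j) (by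
            have := hd0 j
            positivity)
    calc M.errSq u p ≤ ∑ j, M.size * (2 * B * d j + 2 * Λ * c j ^ 2) :=
          Finset.sum_le_sum fun j _ => hcell j
      _ = M.size * (2 * B * ∑ j, d j + 2 * Λ * ∑ j, c j ^ 2) := by
          rw [← Finset.mul_sum, Finset.sum_add_distrib, ← Finset.mul_sum, ← Finset.mul_sum]
      _ ≤ M.size * (2 * B * ∑ j, d j +
            2 * Λ * (2 * (t ^ 2 + (1 - t) ^ 2) * B / κ * ∑ j, d j)) := by
          have := M.size_pos.le
          gcongr
      _ = _ := by ring

/-! ### Constants and mean-zero elements -/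

theorem const_apply (c : ℝ) (j : Fin N) : (const N k c j : ℝ[X]) = C c := rfl

theorem inner_const (v : DGSpace N k) (c : ℝ) :
    M.inner v (const N k c) = c * ∑ j, ∫ x in M.left j..M.right j, (v j : ℝ[X]).eval x := by
  rw [inner_apply, Finset.mul_sum]
  refine Finset.sum_congr rfl fun j _ => ?_
  simp [const_apply, mul_comm]

theorem mem_zeroMean_iff {v : DGSpace N k} : v ∈ M.zeroMean ↔ M.inner v (const N k 1) = 0 := by
  rw [inner_const, one_mul]; rfl

theorem inner_const_of_mem {v : DGSpace N k} (hv : v ∈ M.zeroMean) (c : ℝ) :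
    M.inner v (const N k c) = 0 := by
  have : ∑ j, ∫ x in M.left j..M.right j, (v j : ℝ[X]).eval x = 0 := hv
  rw [inner_const, this, mul_zero]

theorem add_mem_zeroMean {v w : DGSpace N k} (hv : v ∈ M.zeroMean) (hw : w ∈ M.zeroMean) :
    v + w ∈ M.zeroMean := by
  rw [mem_zeroMean_iff] at *
  rw [LinearMap.map_add₂, hv, hw, add_zero]

theorem sub_mem_zeroMean {v w : DGSpace N k} (hv : v ∈ M.zeroMean) (hw : w ∈ M.zeroMean) :
    v - w ∈ M.zeroMean := by
  rw [mem_zeroMean_iff] at *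
  rw [LinearMap.map_sub₂, hv, hw, sub_zero]

theorem inner_const_const (c d : ℝ) :
    M.inner (const N k c) (const N k d) = d * (c * (b - a)) := by
  rw [inner_const]
  simp only [const_apply, eval_C]
  rw [M.sum_integral_cells intervalIntegrable_const, intervalIntegral.integral_const, smul_eq_mul,
    mul_comm c]

/-- Removing the mean is an orthogonal projection, so it does not increase the norm. -/
theorem exists_sub_const_mem_zeroMean (hab : a < b) (v : DGSpace N k) : ∃ c : ℝ,
    v - const N k c ∈ M.zeroMean ∧
      M.inner (v - const N k c) (v - const N k c) ≤ M.inner v v := by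
  have hpos := (sub_pos.2 hab).ne'
  set c := M.inner v (const N k 1) / (b - a) with hc
  have hmem : v - const N k c ∈ M.zeroMean := by
    rw [mem_zeroMean_iff, LinearMap.map_sub₂, inner_const_const, hc]
    field_simp
    ring
  refine ⟨c, hmem, ?_⟩
  have h1 := M.inner_const_of_mem hmem c
  have h2 := M.inner_self_nonneg (const N k c)
  have h3 : M.inner v v = M.inner (v - const N k c + const N k c) (v - const N k c + const N k c) :=
    by rw [sub_add_cancel]
  have h4 := M.inner_comm (v - const N k c) (const N k c)
  set z := v - const N k c
  rw [h3, LinearMap.map_add₂, map_add, map_add, h1, ← h4, h1]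
  linarith

theorem inner_proj₀_const {f : ℝ → ℝ} (hf : IntervalIntegrable f volume a b) (c : ℝ) :
    M.inner (M.proj₀ k f) (const N k c) = c * ∫ x in a..b, f x := by
  rw [M.inner_proj₀ hf, ← M.sum_integral_cells hf, Finset.mul_sum]
  refine Finset.sum_congr rfl fun j _ => ?_
  simp [const_apply, mul_comm]

theorem proj₀_sub_const_mem {f : ℝ → ℝ} (hab : a < b) (hf : IntervalIntegrable f volume a b) :
    M.proj₀ k f - const N k ((∫ x in a..b, f x) / (b - a)) ∈ M.zeroMean := by
  have hpos := (sub_pos.2 hab).ne'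
  rw [mem_zeroMean_iff, LinearMap.map_sub₂, inner_const_const, M.inner_proj₀_const hf]
  field_simp
  ring

theorem proj₀_toFun (v : DGSpace N k) : M.proj₀ k (M.toFun v) = v := by
  refine M.ext_inner fun z => ?_
  have hi : IntervalIntegrable (M.toFun v) volume a b :=
    M.integrable_toFun_comp (F := fun _ y => y) v fun p =>
      Continuous.intervalIntegrable (by fun_prop) _ _
  rw [M.inner_proj₀ hi, inner_apply]
  exact Finset.sum_congr rfl fun j _ =>
    M.integral_toFun_congr (fun x y => y * (z j : ℝ[X]).eval x) v j

theorem measurable_toFun (v : DGSpace N k) : Measurable (M.toFun v) := by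
  unfold toFun
  exact Finset.measurable_sum _ fun j _ =>
    (Polynomial.continuous _).measurable.indicator measurableSet_Ico

theorem continuousAt_toFun (v : DGSpace N k) {j : Fin N} {x : ℝ}
    (hx : x ∈ Set.Ioo (M.left j) (M.right j)) : ContinuousAt (M.toFun v) x := by
  refine (Polynomial.continuous (v j : ℝ[X])).continuousAt.congr ?_
  filter_upwards [isOpen_Ioo.mem_nhds hx] with y hy
  exact (M.toFun_eq v (Set.Ioo_subset_Ico_self hy)).symm

theorem proj₀_zero : M.proj₀ k (fun _ => 0) = 0 :=
  M.ext_inner fun v => by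
    rw [M.inner_proj₀ intervalIntegrable_const]
    simp

/-! ### The DG operator: commuting relation, transpose, stability, bijectivity -/

section Periodic

variable [NeZero N]

theorem dgForm_apply (t : ℝ) (w v : DGSpace N k) : M.dgForm t w v =
    -(∑ j, ∫ x in M.left j..M.right j, (w j : ℝ[X]).eval x * (derivative (v j : ℝ[X])).eval x)
      - ∑ j, M.flux t j w * M.jump j v := rfl

/-- `D_{h,θ}` applied to a generalized Gauss-Radau projection of `u` is the `L²` projection of the
derivative of `u`. -/
theorem D_eq_proj₀ {t : ℝ} {u z : ℝ → ℝ} {p : DGSpace N k} (hu : ContinuousOn u (Set.Icc a b))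
    (hper : u a = u b) (hz : IntervalIntegrable z volume a b)
    (hd : ∀ j, ∀ x ∈ Set.Ioo (M.left j) (M.right j), HasDerivAt u (z x) x)
    (horth : ∀ j, ∀ q ∈ degreeLT ℝ k, ∫ x in M.left j..M.right j, (p j : ℝ[X]).eval x * q.eval x =
        ∫ x in M.left j..M.right j, u x * q.eval x)
    (hflux : ∀ j, M.flux t j p = u (M.right j)) : M.D k t p = M.proj₀ k z := by
  refine M.ext_inner fun v => ?_
  rw [inner_D, M.inner_proj₀ hz, dgForm_apply]
  have hibp : ∀ j, ∫ x in M.left j..M.right j,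
      (p j : ℝ[X]).eval x * (derivative (v j : ℝ[X])).eval x =
      u (M.right j) * (v j : ℝ[X]).eval (M.right j) - u (M.left j) * (v j : ℝ[X]).eval (M.left j) -
        ∫ x in M.left j..M.right j, z x * (v j : ℝ[X]).eval x := fun j => by
    -- The derivative of a test function has degree less than `k`, so `p` may be replaced by `u`
    -- before integrating by parts.
    rw [horth j _ (derivative_mem_degreeLT (v j).2)]
    have hlr := (M.left_lt_right j).le
    refine intervalIntegral.integral_mul_deriv_eq_deriv_mul_of_hasDerivAt
      (M.continuousOn_cell hu j) (Polynomial.continuous _).continuousOn ?_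
      (fun x _ => Polynomial.hasDerivAt _ x) (M.intervalIntegrable_cell hz j)
      (Continuous.intervalIntegrable (by fun_prop) _ _)
    rw [min_eq_left hlr, max_eq_right hlr]
    exact hd j
  have hs : ∑ j, u (M.right j) * (v (j + 1) : ℝ[X]).eval (M.left (j + 1)) =
      ∑ j, u (M.left j) * (v j : ℝ[X]).eval (M.left j) := by
    rw [← sum_comp_add_one fun j => u (M.left j) * (v j : ℝ[X]).eval (M.left j)]
    exact Finset.sum_congr rfl fun j _ => by rw [M.right_eq_left_succ hper j]
  simp only [hibp, hflux, jump, tracePlus, traceMinus, mul_sub, Finset.sum_sub_distrib, hs]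
  ring

/-- A constant is its own Gauss-Radau projection, and its derivative is zero. -/
theorem D_const (t c : ℝ) : M.D k t (const N k c) = 0 := by
  rw [← M.proj₀_zero]
  refine M.D_eq_proj₀ (u := fun _ => c) continuousOn_const rfl intervalIntegrable_const
    (fun j x _ => hasDerivAt_const x c) (fun j q _ => ?_) (fun j => ?_)
  · simp [const_apply]
  · simp only [flux, traceMinus, tracePlus, const_apply, eval_C]; ring

theorem D_mem_zeroMean (t : ℝ) (w : DGSpace N k) : M.D k t w ∈ M.zeroMean := by
  rw [mem_zeroMean_iff, inner_D, dgForm_apply]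
  simp [const_apply, jump, tracePlus, traceMinus]

/-- The transpose of `D_{h,θ}` is `-D_{h,1-θ}`. -/
theorem inner_D_left (t : ℝ) (w v : DGSpace N k) :
    M.inner (M.D k t w) v = -M.inner w (M.D k (1 - t) v) := by
  rw [M.inner_comm w, inner_D, inner_D, dgForm_apply, dgForm_apply]
  have hibp : ∀ j, ∫ x in M.left j..M.right j,
      (w j : ℝ[X]).eval x * (derivative (v j : ℝ[X])).eval x =
      (w j : ℝ[X]).eval (M.right j) * (v j : ℝ[X]).eval (M.right j) -
        (w j : ℝ[X]).eval (M.left j) * (v j : ℝ[X]).eval (M.left j) -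
        ∫ x in M.left j..M.right j, (v j : ℝ[X]).eval x * (derivative (w j : ℝ[X])).eval x :=
    fun j => by
      simp only [mul_comm ((v j : ℝ[X]).eval _)]
      exact intervalIntegral.integral_mul_deriv_eq_deriv_mul
        (fun x _ => Polynomial.hasDerivAt _ x) (fun x _ => Polynomial.hasDerivAt _ x)
        (Continuous.intervalIntegrable (by fun_prop) _ _)
        (Continuous.intervalIntegrable (by fun_prop) _ _)
  have hs : ∑ j, (w j : ℝ[X]).eval (M.left j) * (v j : ℝ[X]).eval (M.left j) =
      ∑ j, M.tracePlus j w * M.tracePlus j v :=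
    (sum_comp_add_one fun j => (w j : ℝ[X]).eval (M.left j) * (v j : ℝ[X]).eval (M.left j)).symm
  have hs' : ∑ j, (w j : ℝ[X]).eval (M.right j) * (v j : ℝ[X]).eval (M.right j) =
      ∑ j, M.traceMinus j w * M.traceMinus j v := rfl
  -- With the weights exchanged, the mixed products `w⁻v⁺` and `w⁺v⁻` cancel; what remains are the
  -- boundary terms of the integration by parts.
  have hf : ∑ j, M.flux t j w * M.jump j v + ∑ j, M.flux (1 - t) j v * M.jump j w =
      ∑ j, M.tracePlus j w * M.tracePlus j v - ∑ j, M.traceMinus j w * M.traceMinus j v := by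
    rw [← Finset.sum_add_distrib, ← Finset.sum_sub_distrib]
    refine Finset.sum_congr rfl fun j _ => ?_
    simp only [flux, jump]; ring
  simp only [hibp, Finset.sum_sub_distrib, hs, hs']
  linarith

/-- Solvability of `D_{h,θ} y = z` in `Z_h`, with stability in `L²`. -/
theorem exists_D_eq (hab : a < b) (k : ℕ) {t : ℝ} (ht : t ≠ 1 / 2) : ∃ S : ℝ, 0 ≤ S ∧
    ∀ {N : ℕ} [NeZero N] (M : Mesh a b N) (z : DGSpace N k), z ∈ M.zeroMean →
      ∃ y ∈ M.zeroMean, M.D k t y = z ∧ M.inner y y ≤ S * M.inner z z := by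
  obtain ⟨K, hK, H⟩ := exists_gaussRadau k ht
  -- From `‖p‖² ≤ 2 ‖φ - p‖² + 2 ‖φ‖²`, where `φ` is the primitive of `z` and `p` its Gauss-Radau
  -- projection.
  refine ⟨2 * (K * (b - a) ^ 2) + 2 * (b - a) ^ 2, by positivity, fun {N} _ M z hz => ?_⟩
  have hzInt : IntervalIntegrable (M.toFun z) volume a b :=
    M.integrable_toFun_comp (F := fun _ y => y) z fun p =>
      Continuous.intervalIntegrable (by fun_prop) _ _
  have hzInt2 : IntervalIntegrable (fun x => M.toFun z x ^ 2) volume a b :=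
    M.integrable_toFun_comp (F := fun _ y => y ^ 2) z fun p =>
      Continuous.intervalIntegrable (by fun_prop) _ _
  have hsub : ∀ {x y : ℝ}, a ≤ x → x ≤ y → y ≤ b → IntervalIntegrable (M.toFun z) volume x y :=
    fun {x y} h1 h2 h3 => hzInt.mono_set (by
      rw [Set.uIcc_of_le h2, Set.uIcc_of_le hab.le]; exact Set.Icc_subset_Icc h1 h3)
  have hzz : ∀ j, ∫ x in M.left j..M.right j, M.toFun z x ^ 2 =
      ∫ x in M.left j..M.right j, (z j : ℝ[X]).eval x * (z j : ℝ[X]).eval x := fun j => by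
    rw [M.integral_toFun_congr (fun _ y => y ^ 2) z j]
    simp only [sq]
  have hzz' : ∫ x in a..b, M.toFun z x ^ 2 = M.inner z z := by
    rw [← M.sum_integral_cells hzInt2, inner_apply]
    exact Finset.sum_congr rfl fun j _ => hzz j
  -- Mean zero of `z` makes `φ` periodic. It is differentiable inside the cells only, which is all
  -- that `D_eq_proj₀` asks.
  let φ : ℝ → ℝ := fun x => ∫ y in a..x, M.toFun z y
  have hφ : ContinuousOn φ (Set.Icc a b) := by
    have := intervalIntegral.continuousOn_primitive_interval' hzInt Set.left_mem_uIcc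
    rwa [Set.uIcc_of_le hab.le] at this
  have hφb : φ b = 0 := by
    have h1 : ∑ j, ∫ x in M.left j..M.right j, (z j : ℝ[X]).eval x = 0 := hz
    simp only [φ]
    rw [← M.sum_integral_cells hzInt, ← h1]
    exact Finset.sum_congr rfl fun j _ => M.integral_toFun_congr (fun _ y => y) z j
  have hper : φ a = φ b := by rw [hφb]; exact intervalIntegral.integral_same
  have hderiv : ∀ j, ∀ x ∈ Set.Ioo (M.left j) (M.right j), HasDerivAt φ (M.toFun z x) x :=
    fun j x hx => intervalIntegral.integral_hasDerivAt_right
      (hsub le_rfl ((M.le_left j).trans hx.1.le) (hx.2.le.trans (M.right_le j)))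
      (M.measurable_toFun z).stronglyMeasurable.stronglyMeasurableAtFilter
      (M.continuousAt_toFun z hx)
  have hinc : ∀ {l r : ℝ}, a ≤ l → l < r → r ≤ b → ∀ x ∈ Set.Icc l r,
      (φ x - φ l) ^ 2 ≤ (r - l) * ∫ y in l..r, M.toFun z y ^ 2 := fun {l r} hl hlr hr x hx => by
    have h1 : φ x - φ l = ∫ y in l..x, M.toFun z y :=
      intervalIntegral.integral_interval_sub_left (hsub le_rfl (hl.trans hx.1) (hx.2.trans hr))
        (hsub le_rfl hl (hlr.le.trans hr))
    have h2 : |φ x - φ l| ≤ ∫ y in l..r, |M.toFun z y| := by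
      rw [h1]
      refine (intervalIntegral.abs_integral_le_integral_abs hx.1).trans ?_
      exact intervalIntegral.integral_mono_interval le_rfl hx.1 hx.2
        (Filter.Eventually.of_forall fun y => abs_nonneg _) (hsub hl hlr.le hr).abs
    have h3 : IntervalIntegrable (fun y => M.toFun z y ^ 2) volume l r := hzInt2.mono_set (by
      rw [Set.uIcc_of_le hlr.le, Set.uIcc_of_le hab.le]; exact Set.Icc_subset_Icc hl hr)
    rw [← sq_abs]
    exact (pow_le_pow_left₀ (abs_nonneg _) h2 2).trans
      (sq_integral_abs_le hlr (hsub hl hlr.le hr) h3)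
  obtain ⟨p, horth, hflux, herr⟩ := H M φ hφ hper
  have hDp : M.D k t p = z := by
    rw [M.D_eq_proj₀ hφ hper hzInt hderiv horth hflux, proj₀_toFun]
  have hE : M.errSq φ p ≤ K * (b - a) ^ 2 * M.inner z z := by
    -- On each cell the constant `φ (M.left j)` is a good enough approximant here, because only
    -- stability is wanted.
    have h1 := herr (fun j => M.size * ∫ x in M.left j..M.right j, M.toFun z x ^ 2) fun j =>
      ⟨C (φ (M.left j)), mem_degreeLT.2 (degree_C_le.trans_lt (by exact_mod_cast Nat.succ_pos k)),
        fun x hx => by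
          rw [eval_C]
          refine (hinc (M.le_left j) (M.left_lt_right j) (M.right_le j) x hx).trans ?_
          exact mul_le_mul_of_nonneg_right (M.width_le_size j)
            (intervalIntegral.integral_nonneg (M.left_lt_right j).le fun _ _ => sq_nonneg _)⟩
    rw [← Finset.mul_sum, M.sum_integral_cells hzInt2, hzz'] at h1
    refine h1.trans ?_
    have h2 : M.size * M.size ≤ (b - a) ^ 2 := by
      rw [sq]; exact mul_self_le_mul_self M.size_pos.le M.size_le
    calc _ = K * (M.size * M.size) * M.inner z z := by ring
      _ ≤ _ := mul_le_mul_of_nonneg_right (mul_le_mul_of_nonneg_left h2 hK) (M.inner_self_nonneg z)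
  have hφ2 : ∫ x in a..b, φ x ^ 2 ≤ (b - a) ^ 2 * M.inner z z := by
    have h0 : φ a = 0 := intervalIntegral.integral_same
    calc _ ≤ ∫ x in a..b, (b - a) * M.inner z z := by
          refine intervalIntegral.integral_mono_on hab.le
            (M.intervalIntegrable_of_continuousOn (hφ.pow 2)) intervalIntegrable_const fun x hx => ?_
          have := hinc le_rfl hab le_rfl x hx
          rwa [h0, sub_zero, hzz'] at this
      _ = _ := by rw [intervalIntegral.integral_const, smul_eq_mul]; ring
  have hpp : M.inner p p ≤ 2 * M.errSq φ p + 2 * ∫ x in a..b, φ x ^ 2 := by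
    rw [← M.sum_integral_cells (f := fun x => φ x ^ 2)
      (M.intervalIntegrable_of_continuousOn (hφ.pow 2)), errSq, inner_apply,
      Finset.mul_sum, Finset.mul_sum, ← Finset.sum_add_distrib]
    refine Finset.sum_le_sum fun j _ => ?_
    have hc := M.continuousOn_cell hφ j
    have i1 : IntervalIntegrable (fun x => 2 * (φ x - (p j : ℝ[X]).eval x) ^ 2) volume
        (M.left j) (M.right j) := (ContinuousOn.intervalIntegrable
          ((hc.sub (Polynomial.continuous _).continuousOn).pow 2)).const_mul 2
    have i2 : IntervalIntegrable (fun x => 2 * φ x ^ 2) volume (M.left j) (M.right j) :=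
      (ContinuousOn.intervalIntegrable (hc.pow 2)).const_mul 2
    rw [← intervalIntegral.integral_const_mul, ← intervalIntegral.integral_const_mul,
      ← intervalIntegral.integral_add i1 i2]
    refine intervalIntegral.integral_mono_on (M.left_lt_right j).le
      (Continuous.intervalIntegrable (by fun_prop) _ _) (i1.add i2) fun x _ => ?_
    nlinarith [sq_nonneg (2 * φ x - (p j : ℝ[X]).eval x)]
  obtain ⟨c, hc, hcle⟩ := M.exists_sub_const_mem_zeroMean hab p
  refine ⟨p - const N k c, hc, by rw [map_sub, D_const, sub_zero, hDp], ?_⟩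
  linarith

/-- Injectivity comes by duality: a difference `w - w'` in the kernel is of the form `D_{h,1-θ} y`,
and is then orthogonal to itself. -/
theorem bijOn_D (hab : a < b) {t : ℝ} (ht : t ≠ 1 / 2) :
    Set.BijOn (M.D k t) M.zeroMean M.zeroMean := by
  refine ⟨fun w _ => M.D_mem_zeroMean t w, fun w hw w' hw' h => ?_, fun z hz => ?_⟩
  · obtain ⟨S, -, H⟩ := exists_D_eq hab k (t := 1 - t) (fun h => ht (by linarith))
    obtain ⟨y, -, hy, -⟩ := H M (w - w') (M.sub_mem_zeroMean hw hw')
    rw [← sub_eq_zero]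
    refine M.inner_self_eq_zero ?_
    have h1 := M.inner_D_left t (w - w') y
    rw [hy, map_sub (M.D k t), show M.D k t w = M.D k t w' from h, sub_self,
      LinearMap.map_zero₂] at h1
    linarith
  · obtain ⟨S, -, H⟩ := exists_D_eq hab k ht
    obtain ⟨y, hy, hyz, -⟩ := H M z hz
    exact ⟨y, hy, hyz⟩

theorem Dinv_mem (hab : a < b) {t : ℝ} (ht : t ≠ 1 / 2) {z : DGSpace N k} (hz : z ∈ M.zeroMean) :
    M.Dinv k t z ∈ M.zeroMean :=
  Function.invFunOn_mem ((M.bijOn_D hab ht).surjOn hz)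

theorem D_Dinv (hab : a < b) {t : ℝ} (ht : t ≠ 1 / 2) {z : DGSpace N k} (hz : z ∈ M.zeroMean) :
    M.D k t (M.Dinv k t z) = z :=
  Function.invFunOn_eq ((M.bijOn_D hab ht).surjOn hz)

end Periodic

end LDG.Mesh

/-! ### Periodic Sobolev functions and their approximation on cells -/

namespace LDG

theorem iteratedDeriv_comp_iteratedDeriv (m n : ℕ) (w : ℝ → ℝ) :
    iteratedDeriv m (iteratedDeriv n w) = iteratedDeriv (m + n) w := by
  simp only [iteratedDeriv_eq_iterate, Function.iterate_add_apply]

theorem l2norm_sq {a b : ℝ} (hab : a ≤ b) (f : ℝ → ℝ) : l2norm a b f ^ 2 = ∫ x in a..b, f x ^ 2 :=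
  Real.sq_sqrt (intervalIntegral.integral_nonneg hab fun _ _ => sq_nonneg _)

theorem sobolevNorm_sq (a b : ℝ) (m : ℕ) (w : ℝ → ℝ) : sobolevNorm a b m w ^ 2 =
    ∑ i ∈ Finset.range (m + 1), l2norm a b (iteratedDeriv i w) ^ 2 :=
  Real.sq_sqrt (Finset.sum_nonneg fun _ _ => sq_nonneg _)

namespace MemPeriodicSobolev

variable {a b : ℝ} {k q m : ℕ} {w : ℝ → ℝ}

theorem iteratedDeriv_left_eq_right (hw : MemPeriodicSobolev a b m w) (i : ℕ) :
    iteratedDeriv i w a = iteratedDeriv i w b := by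
  have h : (fun x => w (x + (b - a))) = w := funext hw.periodic
  have h2 := congrFun (iteratedDeriv_comp_add_const i w (b - a)) a
  rw [h] at h2
  rw [h2]
  congr 1
  ring

theorem continuous_iteratedDeriv (hw : MemPeriodicSobolev a b m w) {i : ℕ} (hi : i < m) :
    Continuous (iteratedDeriv i w) :=
  (hw.contDiff i hi).continuous_iteratedDeriv' i

theorem hasDerivAt_iteratedDeriv (hw : MemPeriodicSobolev a b m w) {i : ℕ} (hi : i + 1 < m)
    (x : ℝ) : HasDerivAt (iteratedDeriv i w) (iteratedDeriv (i + 1) w x) x := by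
  rw [iteratedDeriv_succ]
  have h : ContDiff ℝ ((i : WithTop ℕ∞) + 1) w := by exact_mod_cast hw.contDiff (i + 1) hi
  exact (h.differentiable_iteratedDeriv' i x).hasDerivAt

theorem integral_iteratedDeriv_succ (hw : MemPeriodicSobolev a b m w) {i : ℕ} (hi : i + 1 < m) :
    ∫ x in a..b, iteratedDeriv (i + 1) w x = 0 := by
  rw [intervalIntegral.integral_eq_sub_of_hasDerivAt
    (fun x _ => hw.hasDerivAt_iteratedDeriv hi x)
    ((hw.continuous_iteratedDeriv hi).intervalIntegrable _ _),
    hw.iteratedDeriv_left_eq_right i, sub_self]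

/-- Each `d j` carries a local norm of `∂ₓ^(k+1+i) w`, so the sum over cells is a global norm. The
polynomial approximation contributes `h^(2k)` and Cauchy-Schwarz one more `h`; the last factor `h`
comes from the Gauss-Radau bound. -/
theorem exists_cell_approx (hab : a < b) (hw : MemPeriodicSobolev a b (k + 1 + q) w) {i : ℕ}
    (hi : i ≤ q) {N : ℕ} [NeZero N] (M : Mesh a b N) :
    ∃ d : Fin N → ℝ, (∀ j, ∃ T ∈ degreeLT ℝ (k + 1), ∀ x ∈ Set.Icc (M.left j) (M.right j),
      (iteratedDeriv i w x - T.eval x) ^ 2 ≤ d j) ∧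
      ∑ j, d j ≤ M.size ^ (2 * k + 1) * sobolevNorm a b (k + 1 + q) w ^ 2 := by
  set g := iteratedDeriv (k + 1 + i) w with hg
  have hLp : MemLp g 2 (volume.restrict (Set.Ioc a b)) := hw.memLp _ (by omega)
  have hgi : IntervalIntegrable g volume a b :=
    (intervalIntegrable_iff_integrableOn_Ioc_of_le hab.le).2 (hLp.integrable (by norm_num))
  have hgi2 : IntervalIntegrable (fun x => g x ^ 2) volume a b :=
    (intervalIntegrable_iff_integrableOn_Ioc_of_le hab.le).2 hLp.integrable_sq
  have hcd : ContDiff ℝ k (iteratedDeriv i w) := by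
    rw [iteratedDeriv_eq_iterate]
    exact ContDiff.iterate_deriv' k i (hw.contDiff (k + i) (by omega))
  refine ⟨fun j => M.size ^ (2 * k + 1) * ∫ x in M.left j..M.right j, g x ^ 2, fun j => ?_, ?_⟩
  · have hlr := M.left_lt_right j
    have hac : AbsolutelyContinuousOnInterval (iteratedDeriv k (iteratedDeriv i w))
        (M.left j) (M.right j) := by
      rw [iteratedDeriv_comp_iteratedDeriv]
      refine (hw.absCont (k + i) (by omega)).mono ?_
      rw [Set.uIcc_of_le hlr.le, Set.uIcc_of_le hab.le]
      exact M.Icc_cell_subset j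
    obtain ⟨T, hT, hb⟩ := exists_polynomial_approx hlr k _ hcd hac
    rw [iteratedDeriv_comp_iteratedDeriv] at hb
    refine ⟨T, hT, fun x hx => ?_⟩
    have h0 : 0 ≤ ∫ x in M.left j..M.right j, g x ^ 2 :=
      intervalIntegral.integral_nonneg hlr.le fun _ _ => sq_nonneg _
    calc _ = |iteratedDeriv i w x - T.eval x| ^ 2 := (sq_abs _).symm
      _ ≤ ((M.right j - M.left j) ^ k * ∫ y in M.left j..M.right j, |g y|) ^ 2 :=
          pow_le_pow_left₀ (abs_nonneg _) (hb x hx) 2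
      _ = M.width j ^ (2 * k) * (∫ y in M.left j..M.right j, |g y|) ^ 2 := by
          rw [mul_pow, ← pow_mul, mul_comm k 2]; rfl
      _ ≤ M.width j ^ (2 * k) * (M.width j * ∫ x in M.left j..M.right j, g x ^ 2) :=
          mul_le_mul_of_nonneg_left (sq_integral_abs_le hlr (M.intervalIntegrable_cell hgi j)
            (M.intervalIntegrable_cell hgi2 j)) (pow_nonneg (M.width_pos j).le _)
      _ = M.width j ^ (2 * k + 1) * ∫ x in M.left j..M.right j, g x ^ 2 := by ring
      _ ≤ _ := mul_le_mul_of_nonneg_right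
          (pow_le_pow_left₀ (M.width_pos j).le (M.width_le_size j) _) h0
  · rw [← Finset.mul_sum, M.sum_integral_cells hgi2, ← l2norm_sq hab.le, sobolevNorm_sq]
    refine mul_le_mul_of_nonneg_left ?_ (pow_nonneg M.size_pos.le _)
    exact Finset.single_le_sum (f := fun i => l2norm a b (iteratedDeriv i w) ^ 2)
      (fun _ _ => sq_nonneg _) (Finset.mem_range.2 (by omega))

end MemPeriodicSobolev

namespace Mesh

variable {a b : ℝ} {N k : ℕ} (M : Mesh a b N)

theorem const_zero : const N k 0 = 0 := by
  funext j
  exact Subtype.ext (C_0 (R := ℝ))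

theorem proj₀_const_mul {f : ℝ → ℝ} (hf : IntervalIntegrable f volume a b) (β : ℝ) :
    M.proj₀ k (fun x => β * f x) = β • M.proj₀ k f :=
  M.ext_inner fun v => by
    rw [M.inner_proj₀ (hf.const_mul β), LinearMap.map_smul₂, M.inner_proj₀ hf, smul_eq_mul,
      Finset.mul_sum]
    refine Finset.sum_congr rfl fun j _ => ?_
    rw [← intervalIntegral.integral_const_mul]
    simp only [mul_assoc]

theorem integral_sub_proj₀_mul_toFun {f : ℝ → ℝ} (hf : ContinuousOn f (Set.Icc a b))
    (v : DGSpace N k) :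
    ∫ x in a..b, (f x - M.toFun (M.proj₀ k f) x) * M.toFun v x = 0 := by
  have hfi := M.intervalIntegrable_of_continuousOn hf
  have hfv : IntervalIntegrable (fun x => f x * M.toFun v x) volume a b :=
    M.integrable_toFun_comp (F := fun x y => f x * y) v fun p =>
      M.intervalIntegrable_of_continuousOn (hf.mul p.continuous.continuousOn)
  have hpv : IntervalIntegrable (fun x => M.toFun (M.proj₀ k f) x * M.toFun v x) volume a b :=
    -- Two piecewise factors: the lemma is applied once for each.
    M.integrable_toFun_comp (F := fun x y => M.toFun (M.proj₀ k f) x * y) v fun p =>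
      M.integrable_toFun_comp (F := fun x y => y * p.eval x) (M.proj₀ k f) fun p' =>
        Continuous.intervalIntegrable (by fun_prop) _ _
  simp only [sub_mul]
  rw [intervalIntegral.integral_sub hfv hpv, ← M.sum_integral_cells hfv,
    ← M.sum_integral_cells hpv, sub_eq_zero]
  have h := M.inner_proj₀ hfi v
  rw [inner_apply] at h
  calc _ = ∑ j, ∫ x in M.left j..M.right j, f x * (v j : ℝ[X]).eval x :=
        Finset.sum_congr rfl fun j _ => M.integral_toFun_congr (fun x y => f x * y) v j
    _ = _ := h.symm
    _ = _ := Finset.sum_congr rfl fun j _ => by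
        rw [M.integral_toFun_congr (fun x y => M.toFun (M.proj₀ k f) x * y) v j]
        exact (M.integral_toFun_congr (fun x y => y * (v j : ℝ[X]).eval x) (M.proj₀ k f) j).symm

theorem l2norm_sub_toFun_sq {f : ℝ → ℝ} (hf : ContinuousOn f (Set.Icc a b)) (v : DGSpace N k) :
    l2norm a b (fun x => f x - M.toFun v x) ^ 2 = M.errSq f v := by
  have hi : IntervalIntegrable (fun x => (f x - M.toFun v x) ^ 2) volume a b :=
    M.integrable_toFun_comp (F := fun x y => (f x - y) ^ 2) v fun p =>
      M.intervalIntegrable_of_continuousOn ((hf.sub p.continuous.continuousOn).pow 2)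
  rw [l2norm_sq M.le, ← M.sum_integral_cells hi, errSq]
  exact Finset.sum_congr rfl fun j _ => M.integral_toFun_congr (fun x y => (f x - y) ^ 2) v j

/-! ### Transposes and products of DG operators and of their inverses -/

theorem inner_transpose (A : Module.End ℝ (DGSpace N k)) (v w : DGSpace N k) :
    M.inner (M.transpose A v) w = M.inner v (A w) :=
  LinearMap.BilinForm.isAdjointPairLeftAdjointOfNondegenerate M.inner M.inner_nondegenerate A v w

theorem transpose_one (v : DGSpace N k) : M.transpose 1 v = v :=
  M.ext_inner fun w => M.inner_transpose 1 v w

theorem transpose_mul (A B : Module.End ℝ (DGSpace N k)) (v : DGSpace N k) :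
    M.transpose (A * B) v = M.transpose B (M.transpose A v) :=
  M.ext_inner fun w => by
    rw [inner_transpose, inner_transpose, inner_transpose, Module.End.mul_apply]

section Periodic

variable [NeZero N]

theorem transpose_D (t : ℝ) (v : DGSpace N k) : M.transpose (M.D k t) v = -M.D k (1 - t) v :=
  M.ext_inner fun w => by
    rw [inner_transpose, M.inner_comm, inner_D_left, LinearMap.map_neg₂, M.inner_comm w]

/-- The first alternative occurs for the empty product, that is for `K_h` when `q = 1`. -/
theorem prod_D_const (l : List ℝ) (c : ℝ) : (l.map (M.D k)).prod (const N k c) = const N k c ∨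
    (l.map (M.D k)).prod (const N k c) = 0 := by
  induction l with
  | nil => left; rfl
  | cons t l ih =>
    right
    rw [List.map_cons, List.prod_cons, Module.End.mul_apply]
    rcases ih with h | h <;> rw [h]
    · exact M.D_const t c
    · exact map_zero _

theorem prod_D_const_of_ne_nil {l : List ℝ} (hl : l ≠ []) (c : ℝ) :
    (l.map (M.D k)).prod (const N k c) = 0 := by
  obtain ⟨t, l, rfl⟩ := List.exists_cons_of_ne_nil hl
  rw [List.map_cons, List.prod_cons, Module.End.mul_apply]
  rcases M.prod_D_const l c with h | h <;> rw [h]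
  · exact M.D_const t c
  · exact map_zero _

theorem foldl_Dinv_mem (hab : a < b) {l : List ℝ} (hl : ∀ t ∈ l, t ≠ 1 / 2) :
    ∀ {z : DGSpace N k}, z ∈ M.zeroMean → l.foldl (fun y t => M.Dinv k t y) z ∈ M.zeroMean := by
  induction l with
  | nil => exact fun hz => hz
  | cons t l ih =>
    exact fun hz => ih (fun s hs => hl s (List.mem_cons_of_mem _ hs))
      (M.Dinv_mem hab (hl t List.mem_cons_self) hz)

/-- `foldl` applies the inverse of the head first, while the product applies the operator of the
head last, so the factors cancel from the middle outwards. -/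
theorem prod_D_foldl_Dinv (hab : a < b) {l : List ℝ} (hl : ∀ t ∈ l, t ≠ 1 / 2) :
    ∀ {z : DGSpace N k}, z ∈ M.zeroMean →
      (l.map (M.D k)).prod (l.foldl (fun y t => M.Dinv k t y) z) = z := by
  induction l with
  | nil => exact fun _ => rfl
  | cons t l ih =>
    intro z hz
    have ht := hl t List.mem_cons_self
    rw [List.map_cons, List.prod_cons, Module.End.mul_apply, List.foldl_cons,
      ih (fun s hs => hl s (List.mem_cons_of_mem _ hs)) (M.Dinv_mem hab ht hz), M.D_Dinv hab ht hz]

theorem foldr_Dinv_mem (hab : a < b) {l : List ℝ} (hl : ∀ t ∈ l, t ≠ 1 / 2) {z : DGSpace N k}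
    (hz : z ∈ M.zeroMean) : l.foldr (fun t y => M.Dinv k (1 - t) y) z ∈ M.zeroMean := by
  induction l with
  | nil => exact hz
  | cons t l ih =>
    exact M.Dinv_mem hab (fun h => hl t List.mem_cons_self (by linarith))
      (ih fun s hs => hl s (List.mem_cons_of_mem _ hs))

/-- Transposition reverses the product and turns each `D_{h,θ}` into `-D_{h,1-θ}`; hence `foldr`,
the parameters `1 - t` and the sign. -/
theorem transpose_prod_D_foldr_Dinv (hab : a < b) {l : List ℝ} (hl : ∀ t ∈ l, t ≠ 1 / 2)
    {z : DGSpace N k} (hz : z ∈ M.zeroMean) :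
    M.transpose (l.map (M.D k)).prod (l.foldr (fun t y => M.Dinv k (1 - t) y) z) =
      (-1 : ℝ) ^ l.length • z := by
  induction l with
  | nil => simp [transpose_one]
  | cons t l ih =>
    have hl' : ∀ s ∈ l, s ≠ 1 / 2 := fun s hs => hl s (List.mem_cons_of_mem _ hs)
    rw [List.map_cons, List.prod_cons, transpose_mul, transpose_D, List.foldr_cons,
      M.D_Dinv hab (fun h => hl t List.mem_cons_self (by linarith)) (M.foldr_Dinv_mem hab hl' hz),
      map_neg, ih hl', List.length_cons, pow_succ, mul_neg_one]
    exact (neg_smul _ _).symm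

/-- Error estimate for the successive application of inverses `D_{h,θ}⁻¹`. -/
theorem exists_foldl_Dinv_error (hab : a < b) (k : ℕ) {q : ℕ} (hq : 1 ≤ q) (l : List ℝ)
    (hl : ∀ t ∈ l, t ≠ 1 / 2) (hlen : l.length ≤ q) : ∃ E : ℝ, 0 ≤ E ∧
    ∀ {N : ℕ} [NeZero N] (M : Mesh a b N) (w : ℝ → ℝ), MemPeriodicSobolev a b (k + 1 + q) w →
      ∀ e : DGSpace N k, e = l.foldl (fun y t => M.Dinv k t y) (M.proj₀ k (iteratedDeriv q w)) -
        (M.proj₀ k (iteratedDeriv (q - l.length) w) -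
          const N k ((∫ x in a..b, iteratedDeriv (q - l.length) w x) / (b - a))) →
      M.inner e e ≤ E * (M.size ^ (2 * k + 2) * sobolevNorm a b (k + 1 + q) w ^ 2) := by
  -- The inverse applied last stands at the end of the list. In the base case the error is zero, as
  -- `∂ₓ^q w` has mean zero for `q ≥ 1`.
  induction l using List.reverseRecOn with
  | nil =>
    refine ⟨0, le_rfl, fun M w hw e he => ?_⟩
    obtain ⟨i, rfl⟩ : ∃ i, q = i + 1 := ⟨q - 1, by omega⟩
    rw [List.foldl_nil, List.length_nil, Nat.sub_zero, hw.integral_iteratedDeriv_succ (by omega),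
      zero_div, const_zero, sub_zero, sub_self] at he
    rw [he, map_zero, zero_mul]
  | append_singleton l t ih =>
    have hlen' : l.length + 1 ≤ q := by simpa using hlen
    have hl' : ∀ s ∈ l, s ≠ 1 / 2 := fun s hs => hl s (List.mem_append_left _ hs)
    have ht : t ≠ 1 / 2 := hl t (by simp)
    obtain ⟨E, hE, HE⟩ := ih hl' (by omega)
    obtain ⟨K, hK, HK⟩ := exists_gaussRadau k ht
    obtain ⟨S, hS, HS⟩ := exists_D_eq hab k ht
    obtain ⟨i, hi⟩ : ∃ i, q - l.length = i + 1 := ⟨q - l.length - 1, by omega⟩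
    refine ⟨2 * (S * E) + 2 * K, by positivity, fun {N} _ M w hw e he => ?_⟩
    have hi' : q - (l ++ [t]).length = i := by
      rw [List.length_append, List.length_singleton]; omega
    rw [hi', List.foldl_append, List.foldl_cons, List.foldl_nil] at he
    have hcu := hw.continuous_iteratedDeriv (i := i) (by omega)
    have hcu' := hw.continuous_iteratedDeriv (i := i + 1) (by omega)
    -- `D_{h,t} p` is exactly the function with which the previous iterate was compared.
    obtain ⟨p, horth, hflux, herr⟩ := HK M (iteratedDeriv i w) hcu.continuousOn
      (hw.iteratedDeriv_left_eq_right i)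
    have hDp : M.D k t p = M.proj₀ k (iteratedDeriv (i + 1) w) :=
      M.D_eq_proj₀ hcu.continuousOn (hw.iteratedDeriv_left_eq_right i)
        (hcu'.intervalIntegrable _ _)
        (fun j x _ => hw.hasDerivAt_iteratedDeriv (by omega) x) horth hflux
    obtain ⟨d, hd, hds⟩ := hw.exists_cell_approx hab (i := i) (by omega) M
    set R := M.size ^ (2 * k + 2) * sobolevNorm a b (k + 1 + q) w ^ 2 with hR
    have hp : M.inner (p - M.proj₀ k (iteratedDeriv i w)) (p - M.proj₀ k (iteratedDeriv i w)) ≤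
        K * R := by
      have h1 := M.errSq_eq_add hcu.continuousOn p
      have h2 := M.errSq_nonneg (iteratedDeriv i w) (M.proj₀ k (iteratedDeriv i w))
      have h3 := mul_le_mul_of_nonneg_left hds (mul_nonneg hK M.size_pos.le)
      have h4 := herr d hd
      have h5 : K * M.size * (M.size ^ (2 * k + 1) * sobolevNorm a b (k + 1 + q) w ^ 2) = K * R := by
        rw [hR]; ring
      linarith
    obtain ⟨c, hc, hcle⟩ :=
      M.exists_sub_const_mem_zeroMean hab (p - M.proj₀ k (iteratedDeriv i w))
    set m := (∫ x in a..b, iteratedDeriv i w x) / (b - a)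
    set Q := M.proj₀ k (iteratedDeriv i w) with hQ
    have hQm : Q - const N k m ∈ M.zeroMean :=
      M.proj₀_sub_const_mem hab (hcu.intervalIntegrable _ _)
    set y := l.foldl (fun y t => M.Dinv k t y) (M.proj₀ k (iteratedDeriv q w)) with hy
    have hz : M.proj₀ k (iteratedDeriv q w) ∈ M.zeroMean := by
      obtain ⟨r, rfl⟩ : ∃ r, q = r + 1 := ⟨q - 1, by omega⟩
      have := M.proj₀_sub_const_mem (k := k) hab
        ((hw.continuous_iteratedDeriv (i := r + 1) (by omega)).intervalIntegrable a b)
      rwa [hw.integral_iteratedDeriv_succ (by omega), zero_div, const_zero, sub_zero] at this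
    have hymem : y ∈ M.zeroMean := M.foldl_Dinv_mem hab hl' hz
    have hold : M.inner (y - M.D k t p) (y - M.D k t p) ≤ E * R := by
      refine HE M w hw _ ?_
      rw [hi, hw.integral_iteratedDeriv_succ (by omega), zero_div, const_zero, sub_zero, hDp]
    -- This is `p` shifted by constants into `Z_h`, which does not change its image under `D_{h,t}`.
    -- The mean `m` can be nonzero only for `i = 0`.
    set Y := (p - Q - const N k c) + (Q - const N k m) with hY
    have hYmem : Y ∈ M.zeroMean := M.add_mem_zeroMean hc hQm
    have hDY : M.D k t Y = M.D k t p := by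
      rw [hY]
      simp only [map_add, map_sub, D_const]
      abel
    have hstab : M.inner (M.Dinv k t y - Y) (M.Dinv k t y - Y) ≤ S * (E * R) := by
      have hmem := M.sub_mem_zeroMean (M.Dinv_mem hab ht hymem) hYmem
      have hD : M.D k t (M.Dinv k t y - Y) = y - M.D k t p := by
        rw [map_sub, M.D_Dinv hab ht hymem, hDY]
      -- The stable solution is the given one, by injectivity on `Z_h`.
      obtain ⟨x, hx, hxD, hxS⟩ := HS M _ (M.D_mem_zeroMean t (M.Dinv k t y - Y))
      have hxeq : x = M.Dinv k t y - Y := (M.bijOn_D hab ht).injOn hx hmem hxD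
      rw [hxeq, hD] at hxS
      exact hxS.trans (mul_le_mul_of_nonneg_left hold hS)
    have hsplit : e = (M.Dinv k t y - Y) + (p - Q - const N k c) := by
      rw [he, hY]; abel
    rw [hsplit]
    refine (M.inner_add_self_le _ _).trans ?_
    linarith

end Periodic

end Mesh

end LDG

/-! ### The operator `Π` as one chain of `q` inverses, and the conclusion -/

namespace LDG.Mesh

variable {a b : ℝ} {N k : ℕ} (M : Mesh a b N)

open Classical in
/-- The parameters of the inverses that make up `Π`, in the order of their application. -/
noncomputable def invList (q : ℕ) (θ : ℕ → ℝ) : List ℝ :=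
  ((thetaList θ (q / 2)).map (1 - ·)).reverse ++ (if Even q then [] else [θ 0]) ++
    thetaList θ (q / 2)

theorem length_thetaList (θ : ℕ → ℝ) (γ : ℕ) : (thetaList θ γ).length = γ := by
  simp [thetaList]

theorem length_invList (q : ℕ) (θ : ℕ → ℝ) : (invList q θ).length = q := by
  rw [invList]
  split_ifs with h
  · simp only [List.length_append, List.length_reverse, List.length_map, length_thetaList,
      List.length_nil]
    have := Nat.even_iff.1 h
    omega
  · simp only [List.length_append, List.length_reverse, List.length_map, length_thetaList,
      List.length_singleton]
    have := Nat.not_even_iff.1 h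
    omega

theorem thetaList_ne_half {θ : ℕ → ℝ} {γ : ℕ} (hθ : ∀ i, 1 ≤ i → i ≤ γ → θ i ≠ 1 / 2) :
    ∀ t ∈ thetaList θ γ, t ≠ 1 / 2 := by
  intro t ht
  obtain ⟨i, hi, rfl⟩ := List.mem_map.1 ht
  rw [List.mem_range'_1] at hi
  exact hθ i hi.1 (by omega)

theorem invList_ne_half {q : ℕ} {θ : ℕ → ℝ} (hθ : ∀ i, 1 ≤ i → i ≤ q / 2 → θ i ≠ 1 / 2)
    (hθ₀ : Odd q → θ 0 ≠ 1 / 2) : ∀ t ∈ invList q θ, t ≠ 1 / 2 := by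
  intro t ht
  rw [invList, List.mem_append, List.mem_append, List.mem_reverse, List.mem_map] at ht
  rcases ht with (⟨s, hs, rfl⟩ | ht) | ht
  · exact fun h => thetaList_ne_half hθ s hs (by linarith)
  · split_ifs at ht with h
    · simp at ht
    · rw [List.mem_singleton.1 ht]
      exact hθ₀ (Nat.not_even_iff_odd.1 h)
  · exact thetaList_ne_half hθ t ht

variable [NeZero N]

/-- Writing the inner `foldr` as a `foldl` over the reversed list lets one induction treat both
parities of `q`. -/
theorem ldgProj_eq (q : ℕ) (θ : ℕ → ℝ) (w : ℝ → ℝ) : M.ldgProj k q θ w =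
    (invList q θ).foldl (fun y t => M.Dinv k t y) (M.proj₀ k (iteratedDeriv q w)) +
      const N k ((∫ x in a..b, w x) / (b - a)) := by
  have h1 : ∫ _x in a..b, (1 : ℝ) = b - a := by simp
  rw [ldgProj, h1, invList]
  congr 1
  split_ifs with h <;>
  simp only [outerInv, innerInv, List.foldl_append, List.foldl_reverse, List.foldr_map,
    List.foldl_cons, List.foldl_nil]

theorem Lh_ldgProj (hab : a < b) {q : ℕ} (hq : 1 ≤ q) {θ : ℕ → ℝ}
    (hθ : ∀ i, 1 ≤ i → i ≤ q / 2 → θ i ≠ 1 / 2) (hθ₀ : Odd q → θ 0 ≠ 1 / 2) (β : ℝ) {w : ℝ → ℝ}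
    (hz : M.proj₀ k (iteratedDeriv q w) ∈ M.zeroMean) :
    M.Lh k q β θ (M.ldgProj k q θ w) = β • M.proj₀ k (iteratedDeriv q w) := by
  have hl := thetaList_ne_half hθ
  set z := M.proj₀ k (iteratedDeriv q w) with hzdef
  have hsign : ((-1 : ℝ) ^ (q / 2) * β) * (-1) ^ (q / 2) = β := by
    rw [mul_right_comm, ← mul_pow]; simp
  have hin : M.innerInv k (q / 2) θ z ∈ M.zeroMean := M.foldr_Dinv_mem hab hl hz
  have htr : M.transpose (M.K k (q / 2) θ) (M.innerInv k (q / 2) θ z) = (-1 : ℝ) ^ (q / 2) • z := by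
    have := M.transpose_prod_D_foldr_Dinv hab hl hz
    rwa [length_thetaList] at this
  rw [Lh, ldgProj, LinearMap.smul_apply]
  by_cases h : Even q
  · rw [if_pos h, if_pos h, Module.End.mul_apply, map_add]
    -- For even `q ≥ 1` the operator `K_h` has a factor to annihilate the constant; for odd `q` the
    -- operator `D_{h,θ₀}` does so even if `K_h` is the identity.
    have hne : thetaList θ (q / 2) ≠ [] := by
      rw [← List.length_pos_iff, length_thetaList]
      have := Nat.even_iff.1 h
      omega
    have h1 : M.K k (q / 2) θ (M.outerInv k (q / 2) θ (M.innerInv k (q / 2) θ z)) =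
        M.innerInv k (q / 2) θ z := M.prod_D_foldl_Dinv hab hl hin
    have h2 : ∀ c, M.K k (q / 2) θ (const N k c) = 0 := fun c => M.prod_D_const_of_ne_nil hne c
    rw [h1, h2, add_zero, htr, smul_smul, hsign]
  · rw [if_neg h, if_neg h, Module.End.mul_apply, Module.End.mul_apply, map_add]
    have h0 := hθ₀ (Nat.not_even_iff_odd.1 h)
    have h1 : M.K k (q / 2) θ (M.outerInv k (q / 2) θ
        (M.Dinv k (θ 0) (M.innerInv k (q / 2) θ z))) = M.Dinv k (θ 0) (M.innerInv k (q / 2) θ z) :=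
      M.prod_D_foldl_Dinv hab hl (M.Dinv_mem hab h0 hin)
    have h2 : ∀ c, M.D k (θ 0) (M.K k (q / 2) θ (const N k c)) = 0 := fun c => by
      rcases M.prod_D_const (thetaList θ (q / 2)) c with h | h
      · exact (congrArg _ h).trans (M.D_const _ _)
      · exact (congrArg _ h).trans (map_zero _)
    rw [h1, map_add, h2, add_zero, M.D_Dinv hab h0 hin, htr, smul_smul, hsign]

end LDG.Mesh

theorem mainTheorem3 (a b : ℝ) (hab : a < b) (k q : ℕ) (hq : 1 ≤ q) (θ : ℕ → ℝ)
    (hθ : ∀ i, 1 ≤ i → i ≤ q / 2 → θ i ≠ 1 / 2) (hθ₀ : Odd q → θ 0 ≠ 1 / 2) (σ : ℝ) :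
    ∃ C : ℝ, 0 < C ∧ ∀ (N : ℕ) [NeZero N] (M : LDG.Mesh a b N), M.QuasiUniform σ →
      -- the inverses that enter `Π` are well defined
      (∀ t : ℝ, t ≠ 1 / 2 → Set.BijOn (M.D k t) M.zeroMean M.zeroMean) ∧
      ∀ w : ℝ → ℝ, LDG.MemPeriodicSobolev a b (k + 1 + q) w →
        M.proj₀ k (iteratedDeriv q w) ∈ M.zeroMean ∧
        LDG.l2norm a b (fun x => w x - M.toFun (M.ldgProj k q θ w) x) ≤
          C * LDG.sobolevNorm a b (k + 1 + q) w * M.size ^ (k + 1) ∧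
        ∀ β : ℝ,
          M.Lh k q β θ (M.ldgProj k q θ w) = M.proj₀ k (LDG.diffOp β q w) ∧
          ∀ v : LDG.DGSpace N k,
            (∫ x in a..b, (LDG.diffOp β q w x - M.toFun (M.Lh k q β θ (M.ldgProj k q θ w)) x) *
              M.toFun v x) = 0 := by
  obtain ⟨E, hE, HE⟩ := LDG.Mesh.exists_foldl_Dinv_error hab k hq (LDG.Mesh.invList q θ)
    (LDG.Mesh.invList_ne_half hθ hθ₀) (LDG.Mesh.length_invList q θ).le
  -- Any parameter other than `1/2` would do: this projection serves only as a competitor bounding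
  -- the error of `Π₀ w`. The `+ 1` in the next line makes the constant positive.
  obtain ⟨K, hK, HK⟩ := LDG.Mesh.exists_gaussRadau k (t := 0) (by norm_num)
  refine ⟨√(K + E) + 1, by positivity, fun N _ M _ => ⟨fun t ht => M.bijOn_D hab ht,
    fun w hw => ?_⟩⟩
  have hcq := hw.continuous_iteratedDeriv (i := q) (by omega)
  have hz : M.proj₀ k (iteratedDeriv q w) ∈ M.zeroMean := by
    have h := M.proj₀_sub_const_mem (k := k) hab (hcq.intervalIntegrable a b)
    obtain ⟨r, rfl⟩ : ∃ r, q = r + 1 := ⟨q - 1, by omega⟩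
    rwa [hw.integral_iteratedDeriv_succ (by omega), zero_div, LDG.Mesh.const_zero, sub_zero] at h
  refine ⟨hz, ?_, fun β => ?_⟩
  · have hcw : ContinuousOn w (Set.Icc a b) := by
      have := hw.continuous_iteratedDeriv (i := 0) (by omega)
      rw [iteratedDeriv_zero] at this
      exact this.continuousOn
    have hper : w a = w b := by simpa using hw.iteratedDeriv_left_eq_right 0
    set s := LDG.sobolevNorm a b (k + 1 + q) w with hs
    have hs0 : 0 ≤ s := Real.sqrt_nonneg _
    obtain ⟨p, -, -, herr⟩ := HK M w hcw hper
    obtain ⟨d, hd, hds⟩ := hw.exists_cell_approx hab (i := 0) (Nat.zero_le q) M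
    rw [iteratedDeriv_zero] at hd
    -- The chain has length `q`, so the comparison is with `Π₀ w` minus its mean; adding the mean
    -- back gives a bound on `Πw - Π₀ w`.
    have h1 := HE M w hw _ rfl
    rw [LDG.Mesh.length_invList, Nat.sub_self, iteratedDeriv_zero, sub_sub_eq_add_sub] at h1
    have h2 : M.errSq w (M.proj₀ k w) ≤ K * (M.size ^ (2 * k + 2) * s ^ 2) := by
      have h3 := M.errSq_eq_add hcw p
      have h4 := M.inner_self_nonneg (p - M.proj₀ k w)
      have h5 := mul_le_mul_of_nonneg_left hds (mul_nonneg hK M.size_pos.le)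
      have h6 := herr d hd
      have h7 : K * M.size * (M.size ^ (2 * k + 1) * s ^ 2) = K * (M.size ^ (2 * k + 2) * s ^ 2) := by
        ring
      linarith
    have h3 : LDG.l2norm a b (fun x => w x - M.toFun (M.ldgProj k q θ w) x) ^ 2 ≤
        (K + E) * (M.size ^ (2 * k + 2) * s ^ 2) := by
      rw [M.l2norm_sub_toFun_sq hcw, M.errSq_eq_add hcw, M.ldgProj_eq, add_mul]
      exact add_le_add h2 h1
    refine abs_le_of_sq_le_sq' (h3.trans ?_) ?_ |>.2
    · have h4 := M.size_pos.le
      rw [← Real.sq_sqrt (add_nonneg hK hE)]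
      calc √(K + E) ^ 2 * (M.size ^ (2 * k + 2) * s ^ 2) = (√(K + E) * s * M.size ^ (k + 1)) ^ 2 := by
            ring
        _ ≤ _ := by
            rw [Real.sq_sqrt (add_nonneg hK hE)]
            gcongr
            linarith
    · have h4 := M.size_pos.le
      positivity
  · have hLh : M.Lh k q β θ (M.ldgProj k q θ w) = M.proj₀ k (LDG.diffOp β q w) := by
      rw [M.Lh_ldgProj hab hq hθ hθ₀ β hz, ← M.proj₀_const_mul (hcq.intervalIntegrable a b)]
      rfl
    refine ⟨hLh, fun v => ?_⟩
    rw [hLh]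
    exact M.integral_sub_proj₀_mul_toFun (continuous_const.mul hcq).continuousOn v
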